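/- Let $B=(b_{ij})_{0\le i,j\le n-1}$ be a skew-symmetric $n\times n$ matrix with complex entries whose rows sum to zero. An edge joining two indices $i\neq j$ is called smoothable if $b_{ij}\neq 0$ and for every $k\neq i,j$ the quotient $(b_{jk}+b_{ki})/b_{ij}$ is a non-negative integer. Then there is a cycle of smoothable edges passing through all $n$ vertices $0,\dots,n-1$ exactly once (a full smoothable cycle; in particular $n\ge 3$) if and only if there are a permutation matrix $P$ and a scalar $\lambda\in\mathbb{C}\setminus\{0\}$ such that $B=\lambda P^{-1}AP$, where $A$ is one of the following matrices (rows and columns are numbered from zero, and $T$ denotes the cyclic shift of a row by one position to the right, $T(r_0,\dots,r_{n-1})=(r_{n-1},r_0,\dots,r_{n-2})$): * $\mathcal{C}_{n,k,I}$, where $1\le k<n/2$ and $I=(i_0,\dots,i_{d-1})$ is a sequence of zeros and ones of length $d=\gcd(n,k)$, with the exception of $k=1$, $I=(1)$ (for which the matrix is zero). For $0\le s<d$ its $s$-th row is $T^s\,\mathbf{r}(k-i_s)$, where $\mathbf{r}(l)=(0,\underbrace{1,\dots,1}_{l},\underbrace{0,\dots,0}_{n-1-2l},\underbrace{-1,\dots,-1}_{l})$,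 and for $d\le i\le n-1$ its $i$-th row is $T^d$ of its $(i-d)$-th row; * $$\mathcal{X}_4=\begin{pmatrix}0&2&-1&-1\\-2&0&3&-1\\1&-3&0&2\\1&1&-2&0\end{pmatrix},\qquad \mathcal{X}_5=\begin{pmatrix}0&1&1&-1&-1\\-1&0&2&0&-1\\-1&-2&0&2&1\\1&0&-2&0&1\\1&1&-1&-1&0\end{pmatrix};$$ * $\mathcal{Y}_n$ with $n=2(2k+1)$, $k\ge 1$, whose first two rows are $(0,2,\underbrace{1,\dots,1}_{n/2-2},\underbrace{-1,\dots,-1}_{n/2})$ and $(-2,0,\underbrace{1,\dots,1}_{n/2},\underbrace{-1,\dots,-1}_{n/2-2})$, and whose $i$-th row, for $2\le i\le n-1$, is $T^2$ of its $(i-2)$-th row; * $\mathcal{Z}_n$ with $n=5(2k+1)$, $k\ge 1$, whose first five rows are, with $h=(n-1)/2$, $(0,1,1,\dots,1,-1,\dots,-1)$ with the last $1$ in column $h$; $(-1,0,2,2,1,\dots,1,-1,\dots,-1)$ with the last $1$ in column $h$; $(-1,-2,0,2,1,\dots,1,-1,\dots,-1)$ with the last $1$ in column $h+2$; $(-1,-2,-2,0,1,\dots,1,-1,\dots,-1)$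 with the last $1$ in column $h+4$; $(-1,-1,-1,-1,0,1,\dots,1,-1,\dots,-1)$ with the last $1$ in column $h+4$; and whose $i$-th row, for $5\le i\le n-1$, is $T^5$ of its $(i-5)$-th row. -/

import Mathlib

/-- Two indices `i`, `j` span a smoothable edge of `B` if `B i j ≠ 0` and for every `k ≠ i, j` the
quotient `(B j k + B k i) / B i j` is a non-negative integer. -/
def IsSmoothable {n : ℕ} (B : Matrix (Fin n) (Fin n) ℂ) (i j : Fin n) : Prop :=
  B i j ≠ 0 ∧ ∀ k, k ≠ i → k ≠ j → ∃ m : ℕ, (B j k + B k i) / B i j = (m : ℂ)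

theorem IsSmoothable.symm {n : ℕ} {B : Matrix (Fin n) (Fin n) ℂ} (hB : B.transpose = -B)
    {i j : Fin n} (h : IsSmoothable B i j) : IsSmoothable B j i := by
  have hs : ∀ a b, B a b = -B b a := fun a b => congrFun (congrFun hB b) a
  refine ⟨fun h0 => h.1 (by rw [hs i j, h0, neg_zero]), fun k hkj hki => ?_⟩
  obtain ⟨m, hm⟩ := h.2 k hki hkj
  refine ⟨m, ?_⟩
  rw [← hm, hs i k, hs k j, hs j i, div_neg, ← neg_div]
  congr 1
  ring

theorem not_isSmoothable_self {n : ℕ} {B : Matrix (Fin n) (Fin n) ℂ} (hB : B.transpose = -B)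
    (i : Fin n) : ¬ IsSmoothable B i i := fun h =>
  h.1 (self_eq_neg.mp (congrFun (congrFun hB i) i))

/-- The graph on the vertices `0, …, n - 1` formed by the smoothable edges of a skew-symmetric
matrix. -/
def smoothableGraph {n : ℕ} (B : Matrix (Fin n) (Fin n) ℂ) (hB : B.transpose = -B) :
    SimpleGraph (Fin n) where
  Adj i j := IsSmoothable B i j
  symm := ⟨fun _ _ h => h.symm hB⟩
  loopless := ⟨fun i h => not_isSmoothable_self hB i h⟩

/-- A full smoothable cycle: a cycle of smoothable edges that passes through all the vertices. -/
def HasFullSmoothableCycle {n : ℕ} (B : Matrix (Fin n) (Fin n) ℂ) (hB : B.transpose = -B) : Prop :=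
  ∃ (v : Fin n) (p : (smoothableGraph B hB).Walk v v), p.IsHamiltonianCycle

/-- `B` is obtained from the integer matrix `A` by conjugation by a permutation matrix (that is, by
a renumbering `σ` of the indices, which forces the sizes to be equal) and rescaling by a nonzero
complex number `c`. -/
def IsProjEquiv {n m : ℕ} (B : Matrix (Fin n) (Fin n) ℂ) (A : Matrix (Fin m) (Fin m) ℤ) : Prop :=
  ∃ (σ : Fin n ≃ Fin m) (c : ℂ), c ≠ 0 ∧ ∀ i j, B i j = c * (A (σ i) (σ j) : ℂ)

/-- The cyclic shift of a row by one position to the right,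
`(r₀, …, rₙ₋₁) ↦ (rₙ₋₁, r₀, …, rₙ₋₂)`. -/
def cyclicShift {n : ℕ} (r : Fin n → ℤ) : Fin n → ℤ := fun j => r ((finRotate n).symm j)

/-- The row `(0, 1, …, 1, 0, …, 0, -1, …, -1)` of length `n`, with `l` ones, `n - 1 - 2 l` zeros
after them, and `l` minus ones (for `2 l < n`). -/
def basicRow (n l : ℕ) : Fin n → ℤ := fun j =>
  if (j : ℕ) = 0 then 0
  else if (j : ℕ) ≤ l then 1
  else if (j : ℕ) < n - l then 0
  else -1

/-- The matrix `C_{n,k,I}`, where `I` is a sequence of zeros and ones of length `d = gcd n k`: for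
`i < d` the `i`-th row is the `i`-th cyclic shift of `basicRow n (k - I i)`, and every later row
is the `d`-th cyclic shift of the row that is `d` places above it. -/
def matrixC (n k : ℕ) (I : Fin (Nat.gcd n k) → Fin 2) : Matrix (Fin n) (Fin n) ℤ := fun i =>
  cyclicShift^[(i : ℕ)] (basicRow n
    (k - (I ⟨(i : ℕ) % Nat.gcd n k, Nat.mod_lt _ (Nat.gcd_pos_of_pos_left k i.pos)⟩ : ℕ)))

/-- The matrix `X_4`. -/
def matrixX4 : Matrix (Fin 4) (Fin 4) ℤ :=
  !![ 0,  2, -1, -1;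
     -2,  0,  3, -1;
      1, -3,  0,  2;
      1,  1, -2,  0]

/-- The matrix `X_5`. -/
def matrixX5 : Matrix (Fin 5) (Fin 5) ℤ :=
  !![ 0,  1,  1, -1, -1;
     -1,  0,  2,  0, -1;
     -1, -2,  0,  2,  1;
      1,  0, -2,  0,  1;
      1,  1, -1, -1,  0]

/-- The first two rows of `Y_n`, for `n = 2 (2 k + 1)`, `k ≥ 1`:
`(0, 2, 1, …, 1, -1, …, -1)` with `n / 2 - 2` ones, and
`(-2, 0, 1, …, 1, -1, …, -1)` with `n / 2` ones. -/
def rowY (n s : ℕ) : Fin n → ℤ := fun j =>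
  match s, (j : ℕ) with
  | 0, 0 => 0
  | 0, 1 => 2
  | 0, b => if b < n / 2 then 1 else -1
  | _, 0 => -2
  | _, 1 => 0
  | _, b => if b < n / 2 + 2 then 1 else -1

/-- The matrix `Y_n`, for `n = 2 (2 k + 1)`, `k ≥ 1`: after the first two rows, every row is the
second cyclic shift of the row that is two places above it. -/
def matrixY (n : ℕ) : Matrix (Fin n) (Fin n) ℤ := fun i =>
  cyclicShift^[2 * ((i : ℕ) / 2)] (rowY n ((i : ℕ) % 2))

/-- The first five rows of `Z_n`, for `n = 5 (2 k + 1)`, `k ≥ 1`. With `h = (n - 1) / 2` they are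
* `( 0,  1,  1,  1,  1, 1, …, 1, -1, …, -1)`, the last `1` in column `h`,
* `(-1,  0,  2,  2,  1, 1, …, 1, -1, …, -1)`, the last `1` in column `h`,
* `(-1, -2,  0,  2,  1, 1, …, 1, -1, …, -1)`, the last `1` in column `h + 2`,
* `(-1, -2, -2,  0,  1, 1, …, 1, -1, …, -1)`, the last `1` in column `h + 4`,
* `(-1, -1, -1, -1,  0, 1, …, 1, -1, …, -1)`, the last `1` in column `h + 4`,
where the columns are numbered from zero. -/
def rowZ (n s : ℕ) : Fin n → ℤ := fun j =>
  match s, (j : ℕ) with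
  | 0, 0 => 0
  | 0, b => if b ≤ (n - 1) / 2 then 1 else -1
  | 1, 0 => -1
  | 1, 1 => 0
  | 1, 2 => 2
  | 1, 3 => 2
  | 1, b => if b ≤ (n - 1) / 2 then 1 else -1
  | 2, 0 => -1
  | 2, 1 => -2
  | 2, 2 => 0
  | 2, 3 => 2
  | 2, b => if b ≤ (n - 1) / 2 + 2 then 1 else -1
  | 3, 0 => -1
  | 3, 1 => -2
  | 3, 2 => -2
  | 3, 3 => 0
  | 3, b => if b ≤ (n - 1) / 2 + 4 then 1 else -1
  | _, 0 => -1
  | _, 1 => -1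
  | _, 2 => -1
  | _, 3 => -1
  | _, 4 => 0
  | _, b => if b ≤ (n - 1) / 2 + 4 then 1 else -1

/-- The matrix `Z_n`, for `n = 5 (2 k + 1)`, `k ≥ 1`: after the first five rows, every row is the
fifth cyclic shift of the row that is five places above it. -/
def matrixZ (n : ℕ) : Matrix (Fin n) (Fin n) ℤ := fun i =>
  cyclicShift^[5 * ((i : ℕ) / 5)] (rowZ n ((i : ℕ) % 5))

/-! Number the vertices along the cycle by the integers, periodically, and write `c i` for the entry
`(i, i + 1)`. Smoothability of the edge says that, away from the columns `i` and `i + 1`, row `i +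
1` minus row `i` is `c i` times natural numbers. The vanishing row sums force these naturals to add
up to two, so passing to the next row raises two entries, or one entry twice, by `c i`. Comparing
two consecutive steps at the entry `(i, i + 2)` gives `c (i + 1) * (1 + b) = c i * (1 + a)` with `a,
b ≤ 2`. Hence, up to one complex factor, the matrix is real with positive edges: this is
`CyclicBumps`. By skew symmetry the same fact, read along columns, makes every row weakly decreasing
over one period, from `c i` just after the diagonal to `-c (i - 1)` just before the next diagonal.
The classification plays this monotonicity against the bumps and the zero row sums.

The ratio of neighbouring edges is 1, 2, 3, 3/2 or an inverse of these. Ratio 3 is contradictory,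
and 3/2 forces `n = 4` and `X_4` (`ratio_or_isX4At`). If all edges are equal, the entries are 0 and
±1 after scaling, and the numbers of ones in the rows give `C_{n,k,I}` (`isC_of_const`).

Otherwise scale the largest edge to 2 and look at the end of a run of twos. A single 2 between ones
(`IsPeak`) determines two rows, forces `n = 2 m`, and produces another peak `m + 1` places later;
since `2 (m + 1) - n = 2`, peaks sit at every second index, which is `Y_n`. A run of at least two
twos (`IsDrop`) leads either to `X_5` or to `n = 2 s + 1` and another drop `s + 3` places later.
Since `2 (s + 3) - n = 5`, drops recur every five places, which is `Z_n` if 5 divides `n` and absurd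
otherwise.

For the converse it is enough to check, on explicit entries, that consecutive rows differ by natural
multiples of the edge. -/

/-- A skew-symmetric `n`-periodic real matrix indexed by the integers, with positive entries next
to the diagonal and vanishing row sums, in which consecutive rows differ, away from the diagonal, by
two bumps whose height is the entry next to the diagonal. -/
structure CyclicBumps (n : ℤ) (A : ℤ → ℤ → ℝ) : Prop where
  three_le : 3 ≤ n
  skew : ∀ i j, A i j = -A j i
  periodic : ∀ i j, A i (j + n) = A i j
  pos : ∀ i, 0 < A i (i + 1)
  bump : ∀ i, ∃ p q, i + 1 < p ∧ p ≤ q ∧ q < i + n ∧ ∀ v, i + 1 < v → v < i + n →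
    A (i + 1) v = A i v + A i (i + 1) * ((if v = p then 1 else 0) + (if v = q then 1 else 0))
  sum_row : ∀ i, ∑ j ∈ Finset.Ico i (i + n), A i j = 0

/-! ### Sums over integer intervals. -/

section IntSums

theorem sum_Ico_int_split (f : ℤ → ℝ) {a b c : ℤ} (hab : a ≤ b) (hbc : b ≤ c) :
    ∑ j ∈ Finset.Ico a c, f j = ∑ j ∈ Finset.Ico a b, f j + ∑ j ∈ Finset.Ico b c, f j := by
  rw [← Finset.Ico_union_Ico_eq_Ico hab hbc, Finset.sum_union (Finset.Ico_disjoint_Ico_consecutive a b c)]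

theorem sum_Ico_int_first (f : ℤ → ℝ) {a c : ℤ} (h : a < c) :
    ∑ j ∈ Finset.Ico a c, f j = f a + ∑ j ∈ Finset.Ico (a + 1) c, f j := by
  rw [sum_Ico_int_split f (b := a + 1) (by omega) (by omega)]
  congr 1
  have : Finset.Ico a (a + 1) = {a} := by ext x; simp; omega
  simp [this]

theorem sum_Ico_int_last (f : ℤ → ℝ) {a c : ℤ} (h : a < c) :
    ∑ j ∈ Finset.Ico a c, f j = ∑ j ∈ Finset.Ico a (c - 1), f j + f (c - 1) := by
  rw [sum_Ico_int_split f (b := c - 1) (by omega) (by omega)]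
  congr 1
  have : Finset.Ico (c - 1) c = {c - 1} := by ext x; simp; omega
  simp [this]

theorem sum_Ico_int_le (f : ℤ → ℝ) {a b : ℤ} (m : ℝ) (hab : a ≤ b)
    (h : ∀ j, a ≤ j → j < b → f j ≤ m) : ∑ j ∈ Finset.Ico a b, f j ≤ (b - a) * m := by
  have := Finset.sum_le_card_nsmul (Finset.Ico a b) f m
    (fun j hj => h j (Finset.mem_Ico.1 hj).1 (Finset.mem_Ico.1 hj).2)
  rw [Int.card_Ico, nsmul_eq_mul] at this
  have h2 : (((b - a).toNat : ℕ) : ℝ) = b - a := by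
    have : (((b - a).toNat : ℕ) : ℤ) = b - a := Int.toNat_of_nonneg (by omega)
    exact_mod_cast this
  rwa [h2] at this

theorem le_sum_Ico_int (f : ℤ → ℝ) {a b : ℤ} (m : ℝ) (hab : a ≤ b)
    (h : ∀ j, a ≤ j → j < b → m ≤ f j) : (b - a) * m ≤ ∑ j ∈ Finset.Ico a b, f j := by
  have := sum_Ico_int_le (fun j => - f j) (-m) hab (fun j h1 h2 => neg_le_neg (h j h1 h2))
  rw [Finset.sum_neg_distrib] at this
  linarith

theorem sum_Ico_int_eq (f : ℤ → ℝ) {a b : ℤ} (m : ℝ) (hab : a ≤ b)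
    (h : ∀ j, a ≤ j → j < b → f j = m) : ∑ j ∈ Finset.Ico a b, f j = (b - a) * m :=
  le_antisymm (sum_Ico_int_le f m hab fun j h1 h2 => (h j h1 h2).le)
    (le_sum_Ico_int f m hab fun j h1 h2 => (h j h1 h2).ge)

/-- If the terms are at most `m` and the sum is at least what this allows, all terms equal `m`. -/
theorem eq_of_le_sum_Ico_int (f : ℤ → ℝ) {a b : ℤ} (m : ℝ)
    (h : ∀ j, a ≤ j → j < b → f j ≤ m) (hs : (b - a) * m ≤ ∑ j ∈ Finset.Ico a b, f j)
    (j : ℤ) (h1 : a ≤ j) (h2 : j < b) : f j = m := by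
  have e1 := sum_Ico_int_split f h1 h2.le
  have e2 := sum_Ico_int_first f h2
  have e3 := sum_Ico_int_le f m h1 (fun k hk hk' => h k hk (by omega))
  have e4 := sum_Ico_int_le f (a := j + 1) (b := b) m (by omega) (fun k hk hk' => h k (by omega) hk')
  push_cast at e4
  have := h j h1 h2
  nlinarith

end IntSums

/-! ### Periodic functions and predicates on the integers. -/

theorem periodic_add_mul {α : Type*} {f : ℤ → α} {n : ℤ} (h : ∀ i, f (i + n) = f i) (i m : ℤ) :
    f (i + n * m) = f i := by
  have := (show Function.Periodic f n from h).int_mul m i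
  simpa [mul_comm] using this

/-- A periodic predicate that is closed under a shift is closed under every integer combination of
the shift and the period. -/
theorem periodic_closed {P : ℤ → Prop} {n s : ℤ} (hn : 0 < n) (hper : ∀ i, P (i + n) = P i)
    (hs : ∀ i, P i → P (i + s)) {i : ℤ} (hi : P i) (t m : ℤ) : P (i + s * t + n * m) := by
  have nat : ∀ k : ℕ, P (i + s * k) := by
    intro k
    induction k with
    | zero => simpa using hi
    | succ k ih =>
      have := hs _ ih
      rwa [show i + s * ((k + 1 : ℕ) : ℤ) = i + s * k + s by push_cast; ring]
  have h0 : 0 ≤ t + n * |t| := by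
    have : -t ≤ |t| := neg_le_abs t
    nlinarith [abs_nonneg t]
  have h1 := nat (t + n * |t|).toNat
  rw [Int.toNat_of_nonneg h0] at h1
  have h2 := periodic_add_mul hper (i + s * (t + n * |t|)) (m - s * |t|)
  rw [show i + s * (t + n * |t|) + n * (m - s * |t|) = i + s * t + n * m by ring] at h2
  rwa [h2]

/-- A periodic function attains a maximum. -/
theorem periodic_exists_max {α : Type*} [LinearOrder α] {f : ℤ → α} {n : ℤ} (hn : 0 < n)
    (h : ∀ i, f (i + n) = f i) : ∃ i, ∀ j, f j ≤ f i := by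
  obtain ⟨i, -, hi⟩ := Finset.exists_max_image (Finset.Ico 0 n) f ⟨0, by simp [hn]⟩
  refine ⟨i, fun j => ?_⟩
  have h1 := periodic_add_mul h (j % n) (j / n)
  rw [Int.emod_add_mul_ediv] at h1
  rw [h1]
  exact hi _ (Finset.mem_Ico.2 ⟨Int.emod_nonneg _ hn.ne', Int.emod_lt_of_pos _ hn⟩)

/-! ### Monotone rows and the ratios of neighbouring edges. -/

namespace CyclicBumps

variable {n : ℤ} {A : ℤ → ℤ → ℝ}

theorem periodic_left (h : CyclicBumps n A) (i j : ℤ) : A (i + n) j = A i j := by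
  rw [h.skew, h.periodic, h.skew j i, neg_neg]

theorem diag (h : CyclicBumps n A) (i : ℤ) : A i i = 0 := by
  have := h.skew i i
  linarith

theorem edge_periodic (h : CyclicBumps n A) (i : ℤ) : A (i + n) (i + n + 1) = A i (i + 1) := by
  rw [h.periodic_left, show i + n + 1 = i + 1 + n by ring, h.periodic]

/-- The entry in position `j` of the row `i`, shifted by a period, in terms of the column. -/
theorem flip (h : CyclicBumps n A) (i j : ℤ) : A i (j + n) = -A j i := by
  rw [h.periodic, h.skew]

theorem smul (h : CyclicBumps n A) {c : ℝ} (hc : 0 < c) : CyclicBumps n (fun i j => c * A i j) where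
  three_le := h.three_le
  skew i j := by rw [h.skew i j]; ring
  periodic i j := by rw [h.periodic i j]
  pos i := mul_pos hc (h.pos i)
  bump i := by
    obtain ⟨p, q, h1, h2, h3, h4⟩ := h.bump i
    exact ⟨p, q, h1, h2, h3, fun v hv hv' => by rw [h4 v hv hv']; ring⟩
  sum_row i := by rw [← Finset.mul_sum, h.sum_row, mul_zero]

theorem bump_cases (h : CyclicBumps n A) (i : ℤ) : ∃ p q, i + 1 < p ∧ p ≤ q ∧ q < i + n ∧
    (∀ v, i + 1 < v → v < i + n → v ≠ p → v ≠ q → A (i + 1) v = A i v) ∧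
    ((p < q ∧ A (i + 1) p = A i p + A i (i + 1) ∧ A (i + 1) q = A i q + A i (i + 1)) ∨
      (p = q ∧ A (i + 1) p = A i p + 2 * A i (i + 1))) := by
  obtain ⟨p, q, h1, h2, h3, h4⟩ := h.bump i
  refine ⟨p, q, h1, h2, h3, fun v hv hv' hp hq => by rw [h4 v hv hv']; simp [hp, hq], ?_⟩
  rcases h2.lt_or_eq with hlt | rfl
  · left
    refine ⟨hlt, ?_, ?_⟩
    · rw [h4 p h1 (by omega)]; simp [hlt.ne]
    · rw [h4 q (by omega) h3]; simp [hlt.ne']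
  · right
    refine ⟨rfl, ?_⟩
    rw [h4 p h1 h3]; simp; ring

theorem le_next (h : CyclicBumps n A) {i v : ℤ} (h1 : i + 1 < v) (h2 : v < i + n) :
    A i v ≤ A (i + 1) v := by
  obtain ⟨p, q, -, -, -, h4⟩ := h.bump i
  rw [h4 v h1 h2]
  have := h.pos i
  split_ifs <;> linarith

/-- Skew symmetry turns the growth from row `j` to row `j + 1` in the column `i + n` into a descent
along row `i`. -/
theorem anti_step (h : CyclicBumps n A) {i j : ℤ} (h1 : i < j) (h2 : j + 1 < i + n) :
    A i (j + 1) ≤ A i j := by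
  have := h.le_next (i := j) (v := i + n) h2 (by omega)
  rw [h.flip, h.flip] at this
  linarith

theorem anti (h : CyclicBumps n A) {i j k : ℤ} (h1 : i < j) (h2 : j ≤ k) (h3 : k < i + n) :
    A i k ≤ A i j := by
  induction k, h2 using Int.leInduction with
  | base => exact le_rfl
  | succ k hk ih => exact (h.anti_step (by omega) h3).trans (ih (by omega))

theorem last (h : CyclicBumps n A) (i : ℤ) : A i (i + n - 1) = -A (i - 1) i := by
  rw [show i + n - 1 = i - 1 + n by ring, h.flip]

theorem last' (h : CyclicBumps n A) (i : ℤ) : A (i + 1) (i + n) = -A i (i + 1) := h.flip _ _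

theorem le_first (h : CyclicBumps n A) {i j : ℤ} (h1 : i < j) (h2 : j < i + n) :
    A i j ≤ A i (i + 1) := h.anti (by omega) (by omega) h2

theorem last_le (h : CyclicBumps n A) {i j : ℤ} (h1 : i < j) (h2 : j < i + n) :
    -A (i - 1) i ≤ A i j := by
  rw [← h.last]; exact h.anti h1 (by omega) (by omega)

theorem sum_tail (h : CyclicBumps n A) (i : ℤ) :
    ∑ j ∈ Finset.Ico (i + 1) (i + n), A i j = 0 := by
  have h3 := h.three_le
  have := h.sum_row i
  rwa [sum_Ico_int_first _ (by omega), h.diag, zero_add] at this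

/-- The entry `(i, i + 2)` is met twice: as a column in the step from row `i`, and, by skew
symmetry, as a column in the step from row `i + 1`. Each step adds 0, 1 or 2 bumps there; these are
the nine combinations, the three with equal numbers giving equal edges. -/
theorem ratio_cases (h : CyclicBumps n A) (hn : 4 ≤ n) (i : ℤ) :
    A (i + 1) (i + 2) = A i (i + 1) ∨
    (A (i + 1) (i + 2) = 2 * A i (i + 1) ∧ A i (i + 2) = A i (i + 1)) ∨
    (2 * A (i + 1) (i + 2) = A i (i + 1) ∧ A i (i + 2) = A (i + 1) (i + 2)) ∨
    (A (i + 1) (i + 2) = 3 * A i (i + 1) ∧ A i (i + 2) = A i (i + 1)) ∨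
    (3 * A (i + 1) (i + 2) = A i (i + 1) ∧ A i (i + 2) = A (i + 1) (i + 2)) ∨
    (2 * A (i + 1) (i + 2) = 3 * A i (i + 1) ∧ 2 * A i (i + 2) = -A i (i + 1)) ∨
    (3 * A (i + 1) (i + 2) = 2 * A i (i + 1) ∧ 2 * A i (i + 2) = -A (i + 1) (i + 2)) := by
  have hx : A (i + 1) (i + 2) = A i (i + 2) ∨ A (i + 1) (i + 2) = A i (i + 2) + A i (i + 1) ∨
      A (i + 1) (i + 2) = A i (i + 2) + 2 * A i (i + 1) := by
    obtain ⟨p, q, h1, h2, h3, h4⟩ := h.bump i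
    rw [h4 (i + 2) (by omega) (by omega)]
    split_ifs <;> grind
  have hy : -A i (i + 2) = -A i (i + 1) ∨ -A i (i + 2) = -A i (i + 1) + A (i + 1) (i + 2) ∨
      -A i (i + 2) = -A i (i + 1) + 2 * A (i + 1) (i + 2) := by
    obtain ⟨p, q, h1, h2, h3, h4⟩ := h.bump (i + 1)
    have := h4 (i + n) (by omega) (by omega)
    rw [show i + 1 + 1 = i + 2 by ring, h.flip, h.flip] at this
    rw [this]
    split_ifs <;> grind
  have := h.pos i
  have := h.pos (i + 1)
  rw [show i + 1 + 1 = i + 2 by ring] at this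
  rcases hx with hx | hx | hx <;> rcases hy with hy | hy | hy <;> grind

end CyclicBumps

/-! ### Ratio three is impossible, and ratio 3/2 gives `X_4`. -/

namespace CyclicBumps

variable {n : ℤ} {A : ℤ → ℤ → ℝ}

theorem pos' (h : CyclicBumps n A) {i j : ℤ} (hj : j = i + 1) : 0 < A i j := hj ▸ h.pos i

/-- A bump fits between the smallest entry of a row and the largest entry of the next one. -/
theorem edge_le_add (h : CyclicBumps n A) (i : ℤ) :
    A i (i + 1) ≤ A (i - 1) i + A (i + 1) (i + 2) := by
  obtain ⟨p, q, h1, h2, h3, -, h5⟩ := h.bump_cases i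
  have e1 := h.last_le (i := i) (j := p) (by omega) (by omega)
  have e2 := h.le_first (i := i + 1) (j := p) (by omega) (by omega)
  rw [show i + 1 + 1 = i + 2 by ring] at e2
  have := h.pos i
  rcases h5 with ⟨-, h5, -⟩ | ⟨-, h5⟩ <;> linarith

/-- Ratio 3 uses up both bumps in the column `i + 2`, so rows `i` and `i + 1` agree in the column `i
+ 3`. Read as columns `i + n` and `i + 1 + n`, they differ by `2 * A i (i + 1)` in row `i + 2` but
agree in row `i + 3`. With `edge_le_add` this forces the next edge to be `2 * A i (i + 1)`, and then
three bumps would be needed. -/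
theorem ne_three_mul (h : CyclicBumps n A) (hn : 4 ≤ n) (i : ℤ) :
    A (i + 1) (i + 2) ≠ 3 * A i (i + 1) := by
  intro hc
  have p0 := h.pos i
  have p2 := h.pos' (i := i + 2) (j := i + 3) (by ring)
  have hx : A i (i + 2) = A i (i + 1) := by
    rcases h.ratio_cases hn i with r | r | r | r | r | r | r <;> linarith
  have hy : A (i + 1) (i + 3) = A i (i + 3) := by
    obtain ⟨p, q, h1, h2, h3, h4⟩ := h.bump i
    have e := h4 (i + 2) (by omega) (by omega)
    rw [h4 (i + 3) (by omega) (by omega)]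
    split_ifs at e ⊢ <;> first | omega | linarith
  have hz := h.edge_le_add (i + 1)
  rw [show i + 1 + 1 = i + 2 by ring, show i + 1 + 2 = i + 3 by ring, show i + 1 - 1 = i by ring]
    at hz
  have rr := h.ratio_cases hn (i + 1)
  rw [show i + 1 + 1 = i + 2 by ring, show i + 1 + 2 = i + 3 by ring] at rr
  obtain ⟨p, q, h1, h2, h3, h4⟩ := h.bump (i + 2)
  have e1 := h4 (i + n) (by omega) (by omega)
  have e2 := h4 (i + 1 + n) (by omega) (by omega)
  rw [show i + 2 + 1 = i + 3 by ring] at e1 e2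
  rw [h.flip, h.flip] at e1 e2
  split_ifs at e1 e2 <;>
    rcases rr with rr | rr | rr | rr | rr | rr | rr <;> first | omega | linarith

/-- The mirror image of `ne_three_mul`, reading the cycle backwards. -/
theorem three_mul_ne (h : CyclicBumps n A) (hn : 4 ≤ n) (i : ℤ) :
    3 * A (i + 1) (i + 2) ≠ A i (i + 1) := by
  intro hc
  have p0 := h.pos' (i := i + 1) (j := i + 2) (by ring)
  have p2 := h.pos' (i := i - 1) (j := i) (by ring)
  have hx : A i (i + 2) = A (i + 1) (i + 2) := by
    have p1 := h.pos i
    rcases h.ratio_cases hn i with r | r | r | r | r | r | r <;> linarith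
  have hy : A (i - 1) (i + 1) = A (i - 1) (i + 2) := by
    obtain ⟨p, q, h1, h2, h3, h4⟩ := h.bump (i + 1)
    have e := h4 (i + n) (by omega) (by omega)
    have e2 := h4 (i - 1 + n) (by omega) (by omega)
    rw [show i + 1 + 1 = i + 2 by ring] at e e2
    rw [h.flip, h.flip] at e e2
    split_ifs at e e2 <;> first | omega | linarith
  have hz := h.edge_le_add i
  have rr := h.ratio_cases hn (i - 1)
  rw [show i - 1 + 1 = i by ring, show i - 1 + 2 = i + 1 by ring] at rr
  obtain ⟨p, q, h1, h2, h3, h4⟩ := h.bump (i - 1)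
  have e1 := h4 (i + 1) (by omega) (by omega)
  have e2 := h4 (i + 2) (by omega) (by omega)
  rw [show i - 1 + 1 = i by ring] at e1 e2
  split_ifs at e1 e2 <;>
    rcases rr with rr | rr | rr | rr | rr | rr | rr <;> first | omega | linarith

/-- The entries above the diagonal of the matrix `X_4`. -/
def IsX4At (A : ℤ → ℤ → ℝ) (c : ℝ) (i : ℤ) : Prop :=
  A i (i + 1) = 2 * c ∧ A i (i + 2) = -c ∧ A i (i + 3) = -c ∧ A (i + 1) (i + 2) = 3 * c ∧
    A (i + 1) (i + 3) = -c ∧ A (i + 2) (i + 3) = 2 * c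

theorem sum_row_four (h : CyclicBumps 4 A) (i : ℤ) :
    A i (i + 1) + A i (i + 2) + A i (i + 3) = 0 := by
  have := h.sum_tail i
  rw [sum_Ico_int_first _ (by omega), sum_Ico_int_first _ (by omega),
    sum_Ico_int_first _ (by omega)] at this
  rw [show i + 1 + 1 = i + 2 by ring, show i + 2 + 1 = i + 3 by ring] at this
  rw [show i + 3 + 1 = i + 4 by ring] at this
  simp at this
  linarith

/-- From the column `i + 2` on, the `n - 2` entries of row `i` are at most minus half its first
entry and must cancel that entry, so `n ≤ 4`. For `n = 4` the row sums give the rest. -/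
theorem isX4At_of_lt (h : CyclicBumps n A) (hn : 4 ≤ n) {i : ℤ}
    (hi : 2 * A (i + 1) (i + 2) = 3 * A i (i + 1)) (hx : 2 * A i (i + 2) = -A i (i + 1)) :
    n = 4 ∧ IsX4At A (A i (i + 1) / 2) i := by
  have p0 := h.pos i
  have h4 : n = 4 := by
    have e := h.sum_tail i
    rw [sum_Ico_int_first _ (by omega)] at e
    have e2 := sum_Ico_int_le (A i) (a := i + 1 + 1) (b := i + n) (-(A i (i + 1) / 2)) (by omega)
      (fun j h1 h2 => by
        have := h.anti (i := i) (j := i + 2) (k := j) (by omega) (by omega) h2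
        linarith)
    push_cast at e2
    have : (n : ℝ) ≤ 4 := by nlinarith
    have : n ≤ 4 := by exact_mod_cast this
    omega
  subst h4
  have s0 := h.sum_row_four i
  have s1 := h.sum_row_four (i + 1)
  have s2 := h.sum_row_four (i + 2)
  rw [show i + 1 + 1 = i + 2 by ring, show i + 1 + 2 = i + 3 by ring,
    show i + 1 + 3 = i + 4 by ring, h.flip] at s1
  rw [show i + 2 + 1 = i + 3 by ring, show i + 2 + 2 = i + 4 by ring,
    show i + 2 + 3 = i + 1 + 4 by ring, h.flip, h.flip] at s2
  refine ⟨rfl, ?_, ?_, ?_, ?_, ?_, ?_⟩ <;> linarith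

/-- The reverse of `isX4At_of_lt`: now the entries of row `i + 2` before its last one are bounded
below. The copy of `X_4` starts one index earlier, at `i - 1`. -/
theorem isX4At_of_gt (h : CyclicBumps n A) (hn : 4 ≤ n) {i : ℤ}
    (hi : 3 * A (i + 1) (i + 2) = 2 * A i (i + 1)) (hx : 2 * A i (i + 2) = -A (i + 1) (i + 2)) :
    n = 4 ∧ IsX4At A (A i (i + 1) / 3) (i - 1) := by
  have p0 := h.pos i
  have h4 : n = 4 := by
    have e := h.sum_tail (i + 2)
    rw [sum_Ico_int_last _ (by omega), show i + 2 + n - 1 = i + 1 + n by ring, h.flip] at e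
    have e2 := le_sum_Ico_int (A (i + 2)) (a := i + 2 + 1) (b := i + 1 + n)
      (A i (i + 1) / 3) (by omega)
      (fun j h1 h2 => by
        have := h.anti (i := i + 2) (j := j) (k := i + n) (by omega) (by omega) (by omega)
        rw [h.flip] at this
        linarith)
    push_cast at e2
    have : (n : ℝ) ≤ 4 := by nlinarith
    have : n ≤ 4 := by exact_mod_cast this
    omega
  subst h4
  have s0 := h.sum_row_four i
  have s1 := h.sum_row_four (i + 1)
  have s2 := h.sum_row_four (i + 2)
  rw [show i + 1 + 1 = i + 2 by ring, show i + 1 + 2 = i + 3 by ring,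
    show i + 1 + 3 = i + 4 by ring, h.flip] at s1
  rw [show i + 2 + 1 = i + 3 by ring, show i + 2 + 2 = i + 4 by ring,
    show i + 2 + 3 = i + 1 + 4 by ring, h.flip, h.flip] at s2
  rw [show i + 3 = i - 1 + 4 by ring, h.flip] at s0 s1 s2
  refine ⟨rfl, ?_⟩
  unfold IsX4At
  rw [show i - 1 + 1 = i by ring, show i - 1 + 2 = i + 1 by ring, show i - 1 + 3 = i + 2 by ring]
  refine ⟨?_, ?_, ?_, ?_, ?_, ?_⟩ <;> linarith

/-- Outside of the case of the matrix `X_4`, consecutive entries next to the diagonal are equal or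
one of them is the double of the other. -/
theorem ratio_or_isX4At (h : CyclicBumps n A) (hn : 4 ≤ n) :
    (∀ i, A (i + 1) (i + 2) = A i (i + 1) ∨
      (A (i + 1) (i + 2) = 2 * A i (i + 1) ∧ A i (i + 2) = A i (i + 1)) ∨
      (2 * A (i + 1) (i + 2) = A i (i + 1) ∧ A i (i + 2) = A (i + 1) (i + 2))) ∨
    (n = 4 ∧ ∃ c i, 0 < c ∧ IsX4At A c i) := by
  by_contra! hcon
  obtain ⟨⟨i, hi⟩, h4⟩ := hcon
  have p0 := h.pos i
  have n1 := h.ne_three_mul hn i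
  have n2 := h.three_mul_ne hn i
  rcases h.ratio_cases hn i with r | r | r | r | r | r | r
  · exact hi.1 r
  · exact hi.2.1 r.1 r.2
  · exact hi.2.2 r.1 r.2
  · exact n1 r.1
  · exact n2 r.1
  · obtain ⟨e, hX⟩ := h.isX4At_of_lt hn r.1 r.2
    exact h4 e _ _ (by positivity) hX
  · obtain ⟨e, hX⟩ := h.isX4At_of_gt hn r.1 r.2
    exact h4 e _ _ (by positivity) hX

end CyclicBumps

/-! ### Peaks and the matrices `Y_n`. -/

namespace CyclicBumps

variable {n : ℤ} {A : ℤ → ℤ → ℝ}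

/-- An edge of weight two between two edges of weight one. -/
def IsPeak (A : ℤ → ℤ → ℝ) (i : ℤ) : Prop :=
  A (i - 1) i = 1 ∧ A i (i + 1) = 2 ∧ A (i + 1) (i + 2) = 1

/-- Row `i` is at least -1 and row `i + 1` at most 1, so a bump of height 2 can only lift -1 to 1.
Monotonicity makes the two bumps adjacent and fixes every other entry; the zero row sum puts the
first of them half a period after `i`. -/
theorem IsPeak.row (h : CyclicBumps n A) {i : ℤ} (hi : IsPeak A i) :
    ∃ m, n = 2 * m ∧ (∀ j, i + 1 < j → j < i + m → A i j = 1) ∧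
      (∀ j, i + m ≤ j → j < i + n → A i j = -1) ∧
      (∀ j, i + 1 < j → j < i + m + 2 → A (i + 1) j = 1) ∧
      (∀ j, i + m + 2 ≤ j → j < i + n → A (i + 1) j = -1) := by
  obtain ⟨c0, c1, c2⟩ := hi
  obtain ⟨p, q, h1, h2, h3, h4, h5⟩ := h.bump_cases i
  rw [c1] at h5
  have lo : ∀ j, i < j → j < i + n → -1 ≤ A i j := fun j hj hj' => by
    have := h.last_le hj hj'
    rwa [c0] at this
  have up : ∀ j, i + 1 < j → j < i + n → A (i + 1) j ≤ 1 := fun j hj hj' => by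
    have := h.le_first (i := i + 1) hj (by omega)
    rwa [show i + 1 + 1 = i + 2 by ring, c2] at this
  have lp := lo p (by omega) (by omega)
  have up_p := up p (by omega) (by omega)
  rcases h5 with ⟨hlt, h5, h6⟩ | ⟨-, h5⟩
  swap
  · linarith
  have lq := lo q (by omega) (by omega)
  have up_q := up q (by omega) (by omega)
  have hq : q = p + 1 := by
    by_contra hne
    have e1 := h4 (p + 1) (by omega) (by omega) (by omega) (by omega)
    have e2 := h.anti (i := i) (j := p) (k := p + 1) (by omega) (by omega) (by omega)
    have e3 := h.anti (i := i + 1) (j := p + 1) (k := q) (by omega) (by omega) (by omega)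
    linarith
  subst hq
  have r1 : ∀ j, i + 1 < j → j < p → A i j = 1 := fun j hj hj' => by
    have e1 := h4 j hj (by omega) (by omega) (by omega)
    have e2 := up j hj (by omega)
    have e3 := h.anti (i := i + 1) (j := j) (k := p) (by omega) (by omega) (by omega)
    linarith
  have r2 : ∀ j, p ≤ j → j < i + n → A i j = -1 := fun j hj hj' => by
    have e2 := lo j (by omega) hj'
    have e3 := h.anti (i := i) (j := p) (k := j) (by omega) (by omega) (by omega)
    linarith
  have hs := h.sum_tail i
  rw [sum_Ico_int_first _ (by omega), sum_Ico_int_split _ (b := p) (by omega) (by omega), c1,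
    sum_Ico_int_eq _ 1 (by omega) (fun j hj hj' => r1 j (by omega) hj'),
    sum_Ico_int_eq _ (-1) (by omega) r2] at hs
  push_cast at hs
  have hp : 2 * p = 2 * i + n := by
    have : (2 * p : ℝ) = 2 * i + n := by linarith
    exact_mod_cast this
  refine ⟨p - i, by omega, fun j hj hj' => r1 j hj (by omega), fun j hj hj' => r2 j (by omega) hj',
    fun j hj hj' => ?_, fun j hj hj' => ?_⟩
  · rcases lt_or_ge j p with hlt' | hge
    · rw [h4 j hj (by omega) (by omega) (by omega), r1 j hj hlt']
    · obtain rfl | rfl : j = p ∨ j = p + 1 := by omega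
      · linarith
      · linarith
  · rw [h4 j (by omega) (by omega) (by omega) (by omega), r2 j (by omega) (by omega)]

/-- The two rows of the peak, read as columns, show the descent from 1 to -1 in the rows `i + m` and
`i + m + 1`. This leaves no room for an edge above 1 at `i + m`, and the row sum then needs a 2 at
`i + m + 1`. -/
theorem IsPeak.shift (h : CyclicBumps n A) (hn : 4 ≤ n) (hM : ∀ i, A i (i + 1) ≤ 2) {i m : ℤ}
    (hi : IsPeak A i) (hm : n = 2 * m) : IsPeak A (i + (m + 1)) := by
  obtain ⟨m', hm', r1, r2, s1, s2⟩ := hi.row h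
  obtain rfl : m' = m := by omega
  obtain ⟨c0, c1, c2⟩ := hi
  obtain ⟨v, rfl⟩ : ∃ v, v = i + m' := ⟨_, rfl⟩
  have a1 : A (i + m') (i + n) = 1 := by rw [h.flip, r2 _ (by omega) (by omega)]; ring
  have a2 : A (i + m') (i + 1 + n) = -1 := by rw [h.flip, s1 _ (by omega) (by omega)]
  have a3 : A (i + m' + 1) (i + n) = 1 := by rw [h.flip, r2 _ (by omega) (by omega)]; ring
  have a4 : A (i + m' + 1) (i + 1 + n) = -1 := by rw [h.flip, s1 _ (by omega) (by omega)]
  have hM0 := hM (i + m' - 1)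
  have hM1 := hM (i + m')
  have hM2 := hM (i + m' + 1)
  have hM3 := hM (i + m' + 2)
  have p2 := h.pos (i + m' + 2)
  rw [show i + m' - 1 + 1 = i + m' by ring] at hM0
  rw [show i + m' + 1 + 1 = i + m' + 2 by ring] at hM2
  have c1v : 1 ≤ A (i + m') (i + m' + 1) := by
    have := h.le_first (i := i + m') (j := i + n) (by omega) (by omega)
    linarith
  have left : ∀ j, i + m' < j → j ≤ i + n → 1 ≤ A (i + m') j := fun j hj hj' => by
    rw [← a1]; exact h.anti hj hj' (by omega)
  have right : ∀ j, i + n < j → j < i + m' + n → -2 ≤ A (i + m') j := fun j hj hj' => by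
    have := h.last_le (i := i + m') (j := j) (by omega) (by omega)
    linarith
  have right' : ∀ j, i + n < j → j ≤ i + m' + n → A (i + m' + 1) j ≤ -1 := fun j hj hj' => by
    rw [← a4]; exact h.anti (by omega) (by omega) (by omega)
  have top' : ∀ j, i + m' + 1 < j → j ≤ i + n → A (i + m' + 1) j ≤ A (i + m' + 1) (i + m' + 2) :=
    fun j hj hj' => h.anti (by omega) (by omega) (by omega)
  obtain ⟨p, q, h1, h2, h3, h4, h5⟩ := h.bump_cases (i + m')
  -- A taller bump would exceed 2 up to the column `i + n`, and exceed -1 after it.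
  have cv : A (i + m') (i + m' + 1) = 1 := by
    refine le_antisymm ?_ c1v
    by_contra! hgt
    have hp : A (i + m') p + A (i + m') (i + m' + 1) ≤ A (i + m' + 1) p := by
      rcases h5 with ⟨-, h5, -⟩ | ⟨-, h5⟩ <;> linarith
    rcases le_or_gt p (i + n) with hle | hgt'
    · have := left p (by omega) hle
      have := top' p (by omega) hle
      linarith
    · have := right p hgt' (by omega)
      have := right' p hgt' (by omega)
      linarith
  rw [cv] at h5
  have left1 : ∀ j, i + m' < j → j ≤ i + n → A (i + m') j = 1 := fun j hj hj' => by
    refine le_antisymm ?_ (left j hj hj')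
    rw [← cv]; exact h.le_first hj (by omega)
  have right1 : ∀ j, i + n < j → j ≤ i + m' + n → A (i + m' + 1) j = -1 := fun j hj hj' => by
    refine le_antisymm (right' j hj hj') ?_
    have := h.last_le (i := i + m' + 1) (j := j) (by omega) (by omega)
    rwa [show i + m' + 1 - 1 = i + m' by ring, cv] at this
  have hs := h.sum_tail (i + m' + 1)
  rw [sum_Ico_int_split _ (b := i + n + 1) (by omega) (by omega),
    sum_Ico_int_eq _ (-1) (a := i + n + 1) (by omega)
      (fun j hj hj' => right1 j (by omega) (by omega))] at hs
  push_cast at hs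
  have hnm : (n : ℝ) = 2 * m' := by exact_mod_cast hm
  -- Otherwise row `i + m' + 1` would consist of `m' - 1` ones and `m'` minus ones.
  have cv1 : A (i + m' + 1) (i + m' + 2) = 2 := by
    have e : ∀ j, i + m' + 1 < j → j ≤ i + n → A (i + m' + 1) j = 1 ∨ 2 ≤ A (i + m' + 1) j := by
      intro j hj hj'
      have := left1 j (by omega) hj'
      by_cases hjp : j = p
      · subst hjp; right; rcases h5 with ⟨-, h5, -⟩ | ⟨-, h5⟩ <;> linarith
      · by_cases hjq : j = q
        · subst hjq; right; rcases h5 with ⟨-, -, h5⟩ | ⟨h5', h5⟩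
          · linarith
          · omega
        · left; rw [h4 j hj (by omega) hjp hjq, this]
    rcases e (i + m' + 2) (by omega) (by omega) with e1 | e1
    · exfalso
      rw [sum_Ico_int_eq _ 1 (by omega) (fun j hj hj' => by
        rcases e j (by omega) (by omega) with e2 | e2
        · exact e2
        · have := top' j (by omega) (by omega)
          linarith)] at hs
      push_cast at hs
      linarith
    · linarith
  refine ⟨?_, ?_, ?_⟩
  · rw [show i + (m' + 1) - 1 = i + m' by ring, show i + (m' + 1) = i + m' + 1 by ring, cv]
  · rw [show i + (m' + 1) + 1 = i + m' + 2 by ring, show i + (m' + 1) = i + m' + 1 by ring, cv1]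
  · rw [show i + (m' + 1) + 1 = i + m' + 2 by ring, show i + (m' + 1) + 2 = i + m' + 3 by ring]
    rw [show i + m' + 2 + 1 = i + m' + 3 by ring] at p2 hM3
    -- Parity: bumps of height 2 on an odd entry keep it odd, and the next edge is positive and at
    -- most 2, hence 1.
    have e : A (i + m' + 1) (i + m' + 3) = 1 ∨ A (i + m' + 1) (i + m' + 3) = -1 := by
      rcases le_or_gt (i + m' + 3) (i + n) with hle | hgt
      · left
        have hs' := hs
        rw [sum_Ico_int_first _ (by omega), show i + m' + 1 + 1 = i + m' + 2 by ring, cv1] at hs'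
        have lo : ∀ j, i + m' + 2 < j → j ≤ i + n → 1 ≤ A (i + m' + 1) j := fun j hj hj' => by
          rw [← left1 j (by omega) hj']; exact h.le_next (by omega) (by omega)
        have := eq_of_le_sum_Ico_int (fun j => -A (i + m' + 1) j) (a := i + m' + 2 + 1)
          (b := i + n + 1) (-1) (fun j hj hj' => neg_le_neg (lo j (by omega) (by omega)))
          (by rw [Finset.sum_neg_distrib]; push_cast; linarith) (i + m' + 3) (by omega) (by omega)
        linarith
      · right; exact right1 _ hgt (by omega)
    obtain ⟨p', q', -, -, -, h4'⟩ := h.bump (i + m' + 1)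
    have := h4' (i + m' + 3) (by omega) (by omega)
    rw [show i + m' + 1 + 1 = i + m' + 2 by ring, cv1] at this
    split_ifs at this <;> rcases e with e | e <;> linarith

/-- The rows of the matrix `Y_n`, beginning with the row `i`. -/
def IsYAt (n : ℤ) (A : ℤ → ℤ → ℝ) (i : ℤ) : Prop :=
  ∃ k : ℤ, 1 ≤ k ∧ n = 2 * (2 * k + 1) ∧ ∀ t, A (i + 2 * t) (i + 2 * t + 1) = 2 ∧
    (∀ j, i + 2 * t + 1 < j → j < i + 2 * t + (2 * k + 1) → A (i + 2 * t) j = 1) ∧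
    (∀ j, i + 2 * t + (2 * k + 1) ≤ j → j < i + 2 * t + n → A (i + 2 * t) j = -1) ∧
    (∀ j, i + 2 * t + 1 < j → j < i + 2 * t + (2 * k + 1) + 2 → A (i + 2 * t + 1) j = 1) ∧
    (∀ j, i + 2 * t + (2 * k + 1) + 2 ≤ j → j < i + 2 * t + n → A (i + 2 * t + 1) j = -1)

theorem isPeak_periodic (h : CyclicBumps n A) (i : ℤ) : IsPeak A (i + n) = IsPeak A i := by
  unfold IsPeak
  rw [show i + n - 1 = i - 1 + n by ring, show i + n + 1 = i + 1 + n by ring,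
    show i + n + 2 = i + 2 + n by ring]
  simp only [h.periodic, h.periodic_left]

theorem IsPeak.isYAt (h : CyclicBumps n A) (hn : 4 ≤ n) (hM : ∀ i, A i (i + 1) ≤ 2) {i : ℤ}
    (hi : IsPeak A i) : IsYAt n A i := by
  obtain ⟨m, hm, -⟩ := hi.row h
  -- Two shifts by `m + 1` exceed the period `2 m` by 2.
  have cl : ∀ t, IsPeak A (i + 2 * t) := fun t => by
    have := periodic_closed (P := IsPeak A) (n := n) (s := m + 1) (by omega) h.isPeak_periodic
      (fun j hj => hj.shift h hn hM hm) hi (2 * t) (-t)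
    rwa [show i + (m + 1) * (2 * t) + n * -t = i + 2 * t by rw [hm]; ring] at this
  rcases Int.even_or_odd' m with ⟨k, hk | hk⟩
  -- For even `m` both `i + m` and `i + m + 1` would be peaks, though a peak is preceded by an edge
  -- of weight 1.
  · exfalso
    have e1 := cl k
    have e2 := hi.shift h hn hM hm
    rw [← hk] at e1
    have := e1.2.1
    have := e2.1
    rw [show i + (m + 1) - 1 = i + m by ring, show i + (m + 1) = i + m + 1 by ring] at this
    linarith
  · refine ⟨k, by omega, by omega, fun t => ?_⟩
    obtain ⟨m', hm', r⟩ := (cl t).row h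
    obtain rfl : m' = 2 * k + 1 := by omega
    exact ⟨(cl t).2.1, r⟩

end CyclicBumps

/-! ### Drops, the matrix `X_5`, and the bound on the edge at the bump. -/

namespace CyclicBumps

variable {n : ℤ} {A : ℤ → ℤ → ℝ}

/-- Two edges of weight two followed by an edge of weight one. -/
def IsDrop (A : ℤ → ℤ → ℝ) (i : ℤ) : Prop :=
  A (i - 1) i = 2 ∧ A i (i + 1) = 2 ∧ A (i + 1) (i + 2) = 1

theorem isDrop_periodic (h : CyclicBumps n A) (i : ℤ) : IsDrop A (i + n) = IsDrop A i := by
  unfold IsDrop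
  rw [show i + n - 1 = i - 1 + n by ring, show i + n + 1 = i + 1 + n by ring,
    show i + n + 2 = i + 2 + n by ring]
  simp only [h.periodic, h.periodic_left]

/-- The two bumps that lead from the row `i` to the next one, where the edge `i` is the last in a
run of edges of weight two, are adjacent and are in the columns `v` and `v + 1`. -/
structure IsDropAt (n : ℤ) (A : ℤ → ℤ → ℝ) (i v : ℤ) : Prop where
  prev : A (i - 1) i = 2
  edge : A i (i + 1) = 2
  next : A (i + 1) (i + 2) = 1
  lt_left : i + 2 < v
  lt_right : v + 1 < i + n
  second : A i (i + 2) = 1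
  bump_left : A (i + 1) v = A i v + 2
  bump_right : A (i + 1) (v + 1) = A i (v + 1) + 2
  other : ∀ j, i + 1 < j → j < i + n → j ≠ v → j ≠ v + 1 → A (i + 1) j = A i j
  le : A i v ≤ -1
  anti : A i (v + 1) ≤ A i v
  ge : -2 ≤ A i (v + 1)

/-- A double bump would lift an entry of at least -2 to at least 2, above the bound 1 on row `i +
1`. An unbumped column between the two bumps would have to be at most -1 and at least 0. -/
theorem IsDrop.exists_isDropAt (h : CyclicBumps n A) (hn : 4 ≤ n) {i : ℤ} (hi : IsDrop A i) :
    ∃ v, IsDropAt n A i v := by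
  obtain ⟨c0, c1, c2⟩ := hi
  obtain ⟨p, q, h1, h2, h3, h4, h5⟩ := h.bump_cases i
  rw [c1] at h5
  have lo : ∀ j, i < j → j < i + n → -2 ≤ A i j := fun j hj hj' => by
    have := h.last_le hj hj'
    rwa [c0] at this
  have up : ∀ j, i + 1 < j → j < i + n → A (i + 1) j ≤ 1 := fun j hj hj' => by
    have := h.le_first (i := i + 1) hj (by omega)
    rwa [show i + 1 + 1 = i + 2 by ring, c2] at this
  have lp := lo p (by omega) (by omega)
  have up_p := up p (by omega) (by omega)
  rcases h5 with ⟨hlt, h5, h6⟩ | ⟨-, h5⟩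
  swap
  · linarith
  have lq := lo q (by omega) (by omega)
  have up_q := up q (by omega) (by omega)
  have hq : q = p + 1 := by
    by_contra hne
    have e1 := h4 (p + 1) (by omega) (by omega) (by omega) (by omega)
    have e2 := h.anti (i := i) (j := p) (k := p + 1) (by omega) (by omega) (by omega)
    have e3 := h.anti (i := i + 1) (j := p + 1) (k := q) (by omega) (by omega) (by omega)
    linarith
  subst hq
  have hx : A i (i + 2) = 1 := by
    rcases h.ratio_cases hn i with r | r | r | r | r | r | r <;> linarith
  have hp : p ≠ i + 2 := by
    rintro rfl
    linarith
  exact ⟨p, c0, c1, c2, by omega, h3, hx, h5, h6, h4, by linarith,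
    h.anti (by omega) (by omega) (by omega), lq⟩

/-- The entries above the diagonal of the matrix `X_5`. -/
def IsX5At (A : ℤ → ℤ → ℝ) (c : ℝ) (i : ℤ) : Prop :=
  A i (i + 1) = c ∧ A i (i + 2) = c ∧ A i (i + 3) = -c ∧ A i (i + 4) = -c ∧
    A (i + 1) (i + 2) = 2 * c ∧ A (i + 1) (i + 3) = 0 ∧ A (i + 1) (i + 4) = -c ∧
    A (i + 2) (i + 3) = 2 * c ∧ A (i + 2) (i + 4) = c ∧ A (i + 3) (i + 4) = c

namespace IsDropAt

theorem col_left (h : CyclicBumps n A) {i v : ℤ} (d : IsDropAt n A i v) :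
    A v (i + n) = -A i v ∧ A v (i + n + 1) = -A i v - 2 := by
  constructor
  · exact h.flip _ _
  · rw [show i + n + 1 = i + 1 + n by ring, h.flip, d.bump_left]; ring

theorem col_right (h : CyclicBumps n A) {i v : ℤ} (d : IsDropAt n A i v) :
    A (v + 1) (i + n) = -A i (v + 1) ∧ A (v + 1) (i + n + 1) = -A i (v + 1) - 2 := by
  constructor
  · exact h.flip _ _
  · rw [show i + n + 1 = i + 1 + n by ring, h.flip, d.bump_right]; ring

/-- Unequal entries in the columns `v` and `v + 1` of row `i` mean that the step from row `v` bumps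
both columns `i + n` and `i + n + 1`, leaving no others. The bounds then fix the values -1 and -2
and the edge 1 at `v`. Monotonicity gives `v + 2 = i + n`, and the sum of row `v` gives `n = 5`. -/
theorem isX5At (h : CyclicBumps n A) {i v : ℤ}
    (d : IsDropAt n A i v) (hlt : A i (v + 1) < A i v) : n = 5 ∧ IsX5At A 1 v := by
  have l1 := d.lt_left
  have l2 := d.lt_right
  have dle := d.le
  have dge := d.ge
  obtain ⟨a1, a2⟩ := d.col_left h
  obtain ⟨b1, b2⟩ := d.col_right h
  obtain ⟨p, q, h1, h2, h3, h4, h5⟩ := h.bump_cases v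
  have e1 : i + n = p ∨ i + n = q := by
    by_contra! hne
    have := h4 (i + n) (by omega) (by omega) hne.1 hne.2
    linarith
  have e2 : i + n + 1 = p ∨ i + n + 1 = q := by
    by_contra! hne
    have := h4 (i + n + 1) (by omega) (by omega) hne.1 hne.2
    linarith
  obtain rfl : p = i + n := by omega
  obtain rfl : q = i + n + 1 := by omega
  have cv := h.le_first (i := v) (j := i + n) (by omega) (by omega)
  rcases h5 with ⟨-, h5, h6⟩ | ⟨h5, -⟩
  swap
  · omega
  have ha : A i v = -1 := by linarith
  have hb : A i (v + 1) = -2 := by linarith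
  have hc : A v (v + 1) = 1 := by linarith
  have hv : v + 2 = i + n := by
    by_contra hne
    have e3 := h4 (v + 2) (by omega) (by omega) (by omega) (by omega)
    have e4 := h.le_first (i := v) (j := v + 2) (by omega) (by omega)
    have e5 := h.anti (i := v + 1) (j := v + 2) (k := i + n) (by omega) (by omega) (by omega)
    linarith
  rw [← hv, show v + 2 + 1 = v + 3 by ring] at a2 b2 h4 h6
  rw [← hv] at a1 b1 h5
  have hs := h.sum_tail v
  have hr : ∀ j, v + 3 ≤ j → j < v + n → A v j ≤ -1 := fun j hj hj' => by
    have := h.anti (i := v) (j := v + 3) (k := j) (by omega) (by omega) hj'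
    linarith
  rw [sum_Ico_int_first _ (by omega), show v + 1 + 1 = v + 2 by ring,
    sum_Ico_int_first _ (by omega), show v + 2 + 1 = v + 3 by ring] at hs
  have hs2 := sum_Ico_int_le (A v) (-1) (by omega) hr
  push_cast at hs2
  have hn5 : n ≤ 5 := by
    have : (n : ℝ) ≤ 5 := by linarith
    exact_mod_cast this
  obtain rfl : n = 5 := by omega
  obtain rfl : v = i + 3 := by omega
  have hv4 : A (i + 3) (i + 3 + 4) = -1 :=
    eq_of_le_sum_Ico_int (A (i + 3)) (-1) hr (by push_cast; linarith) (i + 3 + 4) (by omega)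
      (by omega)
  refine ⟨rfl, hc, by linarith, by linarith, hv4, ?_, by linarith, ?_, ?_, ?_, ?_⟩
  · linarith
  · rw [h4 _ (by omega) (by omega) (by omega) (by omega), hv4]
  · rw [show i + 3 + 2 = i + 5 by ring, show i + 3 + 3 = i + 1 + 5 by ring, h.periodic,
      h.periodic_left, d.edge]; norm_num
  · rw [show i + 3 + 2 = i + 5 by ring, show i + 3 + 4 = i + 2 + 5 by ring, h.periodic,
      h.periodic_left, d.second]
  · rw [show i + 3 + 3 = i + 1 + 5 by ring, show i + 3 + 4 = i + 2 + 5 by ring, h.periodic,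
      h.periodic_left, d.next]

end IsDropAt

/-- An edge of weight two whose row and next row descend from `2` to `0` between the columns
`i + s` and `i + s + 1`. -/
def IsStep (A : ℤ → ℤ → ℝ) (s i : ℤ) : Prop :=
  A i (i + 1) = 2 ∧ A i (i + s) = 2 ∧ A (i + 1) (i + s) = 2 ∧ A i (i + s + 1) = 0 ∧
    A (i + 1) (i + s + 1) = 0

theorem isStep_periodic (h : CyclicBumps n A) (s i : ℤ) : IsStep A s (i + n) = IsStep A s i := by
  unfold IsStep
  rw [show i + n + s + 1 = i + s + 1 + n by ring, show i + n + s = i + s + n by ring,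
    show i + n + 1 = i + 1 + n by ring]
  simp only [h.periodic, h.periodic_left]

/-- All bumps come after the column `i + s + 1`, so row `i` is a run of 2, a run of 0 and a run of
-2. The row sum makes the outer runs equally long, and the adjacent bumps, read as columns, are a
step at `i + n - s`. -/
theorem IsStep.row (h : CyclicBumps n A) (hM : ∀ i, A i (i + 1) ≤ 2) {s i : ℤ} (hs : 2 ≤ s)
    (hsn : s + 1 < n) (hi : IsStep A s i) :
    (∀ j, i < j → j < i + n → A i j = 2 ∨ A i j = 0 ∨ A i j = -2) ∧ IsStep A s (i + -s) := by
  obtain ⟨c, s1, s2, s3, s4⟩ := hi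
  obtain ⟨p, q, h1, h2, h3, h4, h5⟩ := h.bump_cases i
  rw [c] at h5
  have left : ∀ j, i < j → j ≤ i + s → A i j = 2 := fun j hj hj' => by
    refine le_antisymm ?_ ?_
    · rw [← c]; exact h.le_first hj (by omega)
    · rw [← s1]; exact h.anti hj hj' (by omega)
  have lo : ∀ j, i < j → j < i + n → -2 ≤ A i j := fun j hj hj' => by
    have := h.last_le hj hj'
    have := hM (i - 1)
    rw [show i - 1 + 1 = i by ring] at this
    linarith
  have hp : i + s + 1 < p := by
    have up : A (i + 1) p ≤ 2 :=
      (h.le_first (i := i + 1) h1 (by omega)).trans (hM _)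
    rcases lt_trichotomy p (i + s + 1) with hlt | rfl | hgt
    · have := left p (by omega) (by omega)
      rcases h5 with ⟨-, h5, -⟩ | ⟨-, h5⟩ <;> linarith
    · rcases h5 with ⟨-, h5, -⟩ | ⟨-, h5⟩ <;> linarith
    · exact hgt
  have right : ∀ j, i + s + 1 < j → j < i + n → A (i + 1) j ≤ 0 := fun j hj hj' => by
    rw [← s4]; exact h.anti (by omega) (by omega) (by omega)
  have lp := lo p (by omega) (by omega)
  have rp := right p hp (by omega)
  rcases h5 with ⟨hlt, h5, h6⟩ | ⟨-, h5⟩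
  swap
  · linarith
  have lq := lo q (by omega) (by omega)
  have rq := right q (by omega) (by omega)
  have hq : q = p + 1 := by
    by_contra hne
    have e1 := h4 (p + 1) (by omega) (by omega) (by omega) (by omega)
    have e2 := h.anti (i := i) (j := p) (k := p + 1) (by omega) (by omega) (by omega)
    have e3 := h.anti (i := i + 1) (j := p + 1) (k := q) (by omega) (by omega) (by omega)
    linarith
  subst hq
  have mid : ∀ j, i + s < j → j < p → A i j = 0 := fun j hj hj' => by
    refine le_antisymm ?_ ?_
    · rw [← s3]; exact h.anti (by omega) (by omega) (by omega)
    · rw [← h4 j (by omega) (by omega) (by omega) (by omega)]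
      have := h.anti (i := i + 1) (j := j) (k := p) (by omega) (by omega) (by omega)
      linarith
  have fin : ∀ j, p ≤ j → j < i + n → A i j = -2 := fun j hj hj' => by
    have := h.anti (i := i) (j := p) (k := j) (by omega) (by omega) (by omega)
    have := lo j (by omega) hj'
    linarith
  have hsum := h.sum_tail i
  rw [sum_Ico_int_split _ (b := i + s + 1) (by omega) (by omega),
    sum_Ico_int_split _ (a := i + s + 1) (b := p) (by omega) (by omega),
    sum_Ico_int_eq _ 2 (by omega) (fun j hj hj' => left j (by omega) (by omega)),
    sum_Ico_int_eq _ 0 (by omega) (fun j hj hj' => mid j (by omega) (by omega)),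
    sum_Ico_int_eq _ (-2) (by omega) (fun j hj hj' => fin j (by omega) (by omega))] at hsum
  push_cast at hsum
  have hpe : p = i + n - s := by
    have : (p : ℝ) = i + n - s := by linarith
    exact_mod_cast this
  refine ⟨fun j hj hj' => ?_, ?_⟩
  · rcases le_or_gt j (i + s) with hle | hgt
    · exact Or.inl (left j hj hle)
    · rcases lt_or_ge j p with hlt' | hge
      · exact Or.inr (Or.inl (mid j hgt hlt'))
      · exact Or.inr (Or.inr (fin j hge hj'))
  · have key : IsStep A s p := by
      have e1 : A p (p + s) = 2 := by
        rw [show p + s = i + n by omega, h.flip]; linarith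
      refine ⟨?_, e1, ?_, ?_, ?_⟩
      · refine le_antisymm (hM p) ?_
        rw [← e1]; exact h.le_first (by omega) (by omega)
      · rw [show p + s = i + n by omega, h.flip]; linarith
      · rw [show p + s + 1 = i + 1 + n by omega, h.flip]; linarith
      · rw [show p + s + 1 = i + 1 + n by omega, h.flip]; linarith
    rw [show p = i + -s + n by omega, h.isStep_periodic] at key
    exact key

/-- An edge above 1 at `v` would create a step at `v`. Steps propagate back to row `i`, whose
entries would then be 2, 0 or -2, although the entry next to its edge is 1. -/
theorem IsDropAt.edge_le_one (h : CyclicBumps n A) (hM : ∀ i, A i (i + 1) ≤ 2)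
    (hR : ∀ i, A (i + 1) (i + 2) = A i (i + 1) ∨ A (i + 1) (i + 2) = 2 * A i (i + 1) ∨
      2 * A (i + 1) (i + 2) = A i (i + 1)) {i v : ℤ}
    (d : IsDropAt n A i v) (heq : A i (v + 1) = A i v) : A v (v + 1) ≤ 1 := by
  by_contra! hgt
  have l1 := d.lt_left
  have l2 := d.lt_right
  have dle := d.le
  have dge := d.ge
  obtain ⟨a1, a2⟩ := d.col_left h
  obtain ⟨b1, b2⟩ := d.col_right h
  rw [heq] at b1 b2
  have cv := h.le_first (i := v) (j := i + n) (by omega) (by omega)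
  obtain ⟨p, q, h1, h2, h3, h4, h5⟩ := h.bump_cases v
  have h5' : A v p + A v (v + 1) ≤ A (v + 1) p := by
    rcases h5 with ⟨-, h5, -⟩ | ⟨-, h5⟩ <;> linarith
  -- Up to the column `i + n` a bump would exceed 2, and in the column `i + n + 1` the rows `v` and
  -- `v + 1` agree.
  have hp : i + n + 1 < p := by
    by_contra! hle
    rcases le_or_gt p (i + n) with hle' | hgt'
    · have e1 := h.anti (i := v) (j := p) (k := i + n) (by omega) hle' (by omega)
      have e2 := (h.le_first (i := v + 1) (j := p) (by omega) (by omega)).trans (hM _)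
      linarith
    · obtain rfl : p = i + n + 1 := by omega
      linarith
  have e1 := h.anti (i := v + 1) (j := i + n + 1) (k := p) (by omega) (by omega) (by omega)
  have e2 := h.last_le (i := v) (j := p) (by omega) (by omega)
  have e3 := hM (v - 1)
  rw [show v - 1 + 1 = v by ring] at e3
  have hR' := hR (v - 1)
  rw [show v - 1 + 1 = v by ring, show v - 1 + 2 = v + 1 by ring] at hR'
  -- Fitting the bump forces the previous edge to be 2; of its admissible ratios only equality keeps
  -- this edge in `(1, 2]`.
  have cv2 : A v (v + 1) = 2 := by
    rcases hR' with r | r | r <;> linarith [hM v]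
  have hstep : IsStep A (i + n - v) v := by
    refine ⟨cv2, ?_, ?_, ?_, ?_⟩
    · rw [show v + (i + n - v) = i + n by ring]; linarith
    · rw [show v + (i + n - v) = i + n by ring]; linarith
    · rw [show v + (i + n - v) + 1 = i + n + 1 by ring]; linarith
    · rw [show v + (i + n - v) + 1 = i + n + 1 by ring]; linarith
  have hn := h.three_le
  have hi := periodic_closed (P := IsStep A (i + n - v)) (n := n) (s := -(i + n - v)) (by omega)
    (h.isStep_periodic _) (fun j hj => (hj.row h hM (by omega) (by omega)).2) hstep (-1) (-1)
  rw [show v + -(i + n - v) * -1 + n * -1 = i by ring] at hi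
  have := (hi.row h hM (by omega) (by omega)).1 (i + 2) (by omega) (by omega)
  rw [d.second] at this
  norm_num at this

end CyclicBumps

/-! ### Drops and the matrices `Z_n`. -/

namespace CyclicBumps

variable {n : ℤ} {A : ℤ → ℤ → ℝ}

/-- The first two rows of a block of five rows of the matrix `Z_n`, with `n = 2 s + 1`. -/
structure IsZHead (s n : ℤ) (A : ℤ → ℤ → ℝ) (j : ℤ) : Prop where
  one₀ : ∀ w, j < w → w ≤ j + s → A j w = 1
  neg₀ : ∀ w, j + s < w → w < j + n → A j w = -1
  two₁ : A (j + 1) (j + 2) = 2 ∧ A (j + 1) (j + 3) = 2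
  one₁ : ∀ w, j + 3 < w → w ≤ j + s → A (j + 1) w = 1
  neg₁ : ∀ w, j + s < w → w ≤ j + n → A (j + 1) w = -1

/-- The last three rows of a block of five rows of the matrix `Z_n`, with `n = 2 s + 1`. -/
structure IsZTail (s n : ℤ) (A : ℤ → ℤ → ℝ) (j : ℤ) : Prop where
  two₂ : A (j + 2) (j + 3) = 2
  one₂ : ∀ w, j + 3 < w → w ≤ j + s + 2 → A (j + 2) w = 1
  neg₂ : ∀ w, j + s + 2 < w → w ≤ j + n → A (j + 2) w = -1
  neg_two₂ : A (j + 2) (j + n + 1) = -2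
  one₃ : ∀ w, j + 3 < w → w ≤ j + s + 4 → A (j + 3) w = 1
  neg₃ : ∀ w, j + s + 4 < w → w ≤ j + n → A (j + 3) w = -1
  neg_two₃ : A (j + 3) (j + n + 1) = -2 ∧ A (j + 3) (j + n + 2) = -2
  one₄ : ∀ w, j + 4 < w → w ≤ j + s + 4 → A (j + 4) w = 1
  neg₄ : ∀ w, j + s + 4 < w → w ≤ j + n + 3 → A (j + 4) w = -1

/-- The rows of the matrix `Z_n`, beginning with the row `i`. -/
def IsZAt (n : ℤ) (A : ℤ → ℤ → ℝ) (i : ℤ) : Prop :=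
  ∃ k : ℤ, 1 ≤ k ∧ n = 5 * (2 * k + 1) ∧
    ∀ t, IsZHead (5 * k + 2) n A (i + 5 * t) ∧ IsZTail (5 * k + 2) n A (i + 5 * t)

/-- The sums of the rows `v` and `i` bound `2 v` by `2 i + n + 1` from the two sides. So equality
holds, `n` is odd, and every estimated entry takes its extreme value. -/
theorem IsDropAt.size (h : CyclicBumps n A) {i v : ℤ}
    (d : IsDropAt n A i v) (heq : A i (v + 1) = A i v) (hc : A v (v + 1) ≤ 1) :
    ∃ s, n = 2 * s + 1 ∧ 3 ≤ s ∧ v = i + s + 1 ∧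
      (∀ w, i + 1 < w → w < v → A i w = 1) ∧ (∀ w, v ≤ w → w < i + n - 1 → A i w = -1) ∧
      (∀ w, v < w → w ≤ i + n → A v w = 1) ∧ (∀ w, i + n < w → w < v + n → A v w = -1) := by
  have l1 := d.lt_left
  have l2 := d.lt_right
  have dle := d.le
  obtain ⟨a1, a2⟩ := d.col_left h
  obtain ⟨b1, b2⟩ := d.col_right h
  rw [heq] at b1 b2
  have cv := h.le_first (i := v) (j := i + n) (by omega) (by omega)
  have ha : A i v = -1 := by linarith
  have hlast := h.last i
  rw [d.prev] at hlast
  have l3 : v + 1 < i + n - 1 := by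
    by_contra hle
    rw [show i + n - 1 = v + 1 by omega] at hlast
    linarith
  have left : ∀ w, v < w → w ≤ i + n → A v w = 1 := fun w hw hw' => by
    have := h.le_first (i := v) (j := w) hw (by omega)
    have := h.anti (i := v) (j := w) (k := i + n) hw hw' (by omega)
    linarith
  have right : ∀ w, i + n + 1 ≤ w → w < v + n → A v w ≤ -1 := fun w hw hw' => by
    have := h.anti (i := v) (j := i + n + 1) (k := w) (by omega) hw (by omega)
    linarith
  have ileft : ∀ w, i + 1 < w → w < v → A i w = 1 := fun w hw hw' => by
    have e1 := h.anti (i := i) (j := i + 2) (k := w) (by omega) (by omega) (by omega)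
    rw [d.second] at e1
    have e2 := h.anti (i := i + 1) (j := w) (k := v) (by omega) (by omega) (by omega)
    rw [d.bump_left, d.other w hw (by omega) (by omega) (by omega)] at e2
    linarith
  have iright : ∀ w, v ≤ w → w < i + n - 1 → A i w ≤ -1 := fun w hw hw' => by
    have := h.anti (i := i) (j := v) (k := w) (by omega) hw (by omega)
    linarith
  have s1 := h.sum_tail v
  rw [sum_Ico_int_split _ (b := i + n + 1) (by omega) (by omega),
    sum_Ico_int_eq _ 1 (by omega) (fun j hj hj' => left j (by omega) (by omega))] at s1
  have s1' := sum_Ico_int_le (A v) (-1) (by omega) right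
  have s2 := h.sum_tail i
  rw [sum_Ico_int_first _ (by omega), sum_Ico_int_split _ (b := v) (by omega) (by omega),
    sum_Ico_int_eq _ 1 (by omega) (fun j hj hj' => ileft j (by omega) (by omega)),
    sum_Ico_int_last _ (a := v) (by omega), hlast, d.edge] at s2
  have s2' := sum_Ico_int_le (A i) (a := v) (-1) (by omega) iright
  push_cast at s1 s1' s2 s2'
  have hv : 2 * v = 2 * i + n + 1 := by
    have : (2 * v : ℝ) = 2 * i + n + 1 := by linarith
    exact_mod_cast this
  have hvr : (2 * v : ℝ) = 2 * i + n + 1 := by exact_mod_cast hv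
  exact ⟨v - i - 1, by omega, by omega, by omega, ileft,
    eq_of_le_sum_Ico_int (A i) (-1) iright (by push_cast; linarith), left,
    fun w hw => eq_of_le_sum_Ico_int (A v) (-1) right (by push_cast; linarith) w (by omega)⟩

/-- The drop at `i` is the third row of a block starting at `i - 2`. The next block found starts at
`v = i + s + 1`; its head is forced here, and its third row `v + 2` is the next drop. -/
theorem IsDropAt.isZ (h : CyclicBumps n A) (hM : ∀ i, A i (i + 1) ≤ 2) {i v : ℤ}
    (d : IsDropAt n A i v) (heq : A i (v + 1) = A i v) (hc : A v (v + 1) ≤ 1) :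
    ∃ s, n = 2 * s + 1 ∧ 3 ≤ s ∧ IsZTail s n A (i - 2) ∧ IsZHead s n A (i + s + 1) ∧
      IsDrop A (i + (s + 3)) := by
  obtain ⟨s, hn, hs, rfl, i1, i2, v1, v2⟩ := d.size h heq hc
  have hlast := h.last i
  rw [d.prev] at hlast
  have n1 : ∀ w, i + 1 < w → w ≤ i + s + 2 → A (i + 1) w = 1 := fun w hw hw' => by
    by_cases e1 : w = i + s + 1
    · subst e1; rw [d.bump_left, i2 _ (by omega) (by omega)]; norm_num
    by_cases e2 : w = i + s + 1 + 1
    · subst e2; rw [d.bump_right, i2 _ (by omega) (by omega)]; norm_num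
    rw [d.other w hw (by omega) e1 e2, i1 w hw (by omega)]
  have n2 : ∀ w, i + s + 2 < w → w < i + n - 1 → A (i + 1) w = -1 := fun w hw hw' => by
    rw [d.other w (by omega) (by omega) (by omega) (by omega), i2 w (by omega) (by omega)]
  have n3 : A (i + 1) (i + n - 1) = -2 := by
    rw [d.other _ (by omega) (by omega) (by omega) (by omega), hlast]
  have n4 : A (i + 1) (i + n) = -2 := by rw [h.last', d.edge]
  have tail : IsZTail s n A (i - 2) := by
    rw [show i + n - 1 = i - 2 + n + 1 by ring] at hlast n3
    obtain ⟨p, q, h1, h2, h3, h4⟩ := h.bump (i + 1)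
    rw [show i + 1 + 1 = i + 2 by ring, d.next] at h4
    have ge : ∀ w, i + 2 < w → w ≤ i + n + 1 → -1 ≤ A (i + 2) w := fun w hw hw' => by
      have := h.last_le (i := i + 2) (j := w) hw (by omega)
      rwa [show i + 2 - 1 = i + 1 by ring, d.next] at this
    have e1 := h4 (i - 2 + n + 1) (by omega) (by omega)
    have e2 := h4 (i + n) (by omega) (by omega)
    rw [n3] at e1
    rw [n4] at e2
    have e3 := ge (i - 2 + n + 1) (by omega) (by omega)
    have e4 := ge (i + n) (by omega) (by omega)
    -- Row `i + 2` is at least -1, so both bumps must repair the two entries -2 of row `i + 1`.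
    have hp : p = i - 2 + n + 1 ∧ q = i + n := by
      split_ifs at e1 e2 <;> first | omega | (exfalso; linarith)
    obtain ⟨rfl, rfl⟩ := hp
    have o : ∀ w, i + 2 < w → w < i - 2 + n + 1 → A (i + 2) w = A (i + 1) w := fun w hw hw' => by
      rw [h4 w hw (by omega), if_neg (by omega), if_neg (by omega)]; ring
    refine ⟨?_, fun w hw hw' => ?_, fun w hw hw' => ?_, ?_, fun w hw hw' => ?_, fun w hw hw' => ?_,
      ?_, fun w hw hw' => ?_, fun w hw hw' => ?_⟩
    · rw [show i - 2 + 2 = i by ring, show i - 2 + 3 = i + 1 by ring, d.edge]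
    · rw [show i - 2 + 2 = i by ring]; exact i1 w (by omega) (by omega)
    · rw [show i - 2 + 2 = i by ring]; exact i2 w (by omega) (by omega)
    · rw [show i - 2 + 2 = i by ring, hlast]
    · rw [show i - 2 + 3 = i + 1 by ring]; exact n1 w (by omega) (by omega)
    · rw [show i - 2 + 3 = i + 1 by ring]; exact n2 w (by omega) (by omega)
    · rw [show i - 2 + 3 = i + 1 by ring, show i - 2 + n + 2 = i + n by ring]; exact ⟨n3, n4⟩
    · rw [show i - 2 + 4 = i + 2 by ring, o w (by omega) (by omega)]; exact n1 w (by omega) (by omega)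
    · rw [show i - 2 + 4 = i + 2 by ring]
      rcases lt_or_ge w (i - 2 + n + 1) with hlt | hge
      · rw [o w (by omega) hlt]; exact n2 w (by omega) (by omega)
      · obtain rfl | rfl | rfl : w = i - 2 + n + 1 ∨ w = i + n ∨ w = i + 1 + n := by omega
        · rw [e1, if_pos rfl, if_neg (by omega)]; norm_num
        · rw [e2, if_pos rfl, if_neg (by omega)]; norm_num
        · rw [h.flip, d.next]
  have cv : A (i + s + 1) (i + s + 1 + 1) = 1 := v1 _ (by omega) (by omega)
  obtain ⟨b1, b2⟩ := d.col_right h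
  rw [i2 _ (by omega) (by omega)] at b1 b2
  have head : IsZHead s n A (i + s + 1) := by
    obtain ⟨p, q, h1, h2, h3, h4, h5⟩ := h.bump_cases (i + s + 1)
    rw [cv] at h5
    have right : ∀ w, i + n < w → w < i + s + 1 + n → A (i + s + 1 + 1) w ≤ -1 :=
      fun w hw hw' => by
        have := h.anti (i := i + s + 1 + 1) (j := i + n + 1) (k := w) (by omega) (by omega)
          (by omega)
        linarith
    have top := hM (i + s + 1 + 1)
    have up : ∀ w, i + s + 1 + 1 < w → w < i + s + 1 + n → A (i + s + 1 + 1) w ≤ 2 :=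
      fun w hw hw' => (h.le_first hw (by omega)).trans top
    -- Beyond `i + n` a bump would lift -1 to 0, but row `v + 1` is at most -1 there. Among the
    -- ones, monotonicity pushes both bumps to the front.
    have hp : p ≤ i + n := by
      by_contra! hgt
      have e1 := v2 p hgt (by omega)
      have e2 := right p hgt (by omega)
      rcases h5 with ⟨-, h5, -⟩ | ⟨-, h5⟩ <;> linarith
    have e1 := v1 p (by omega) hp
    rcases h5 with ⟨hlt, h5, h6⟩ | ⟨-, h5⟩
    swap
    · have := up p h1 (by omega)
      linarith
    have hq : q ≤ i + n := by
      by_contra! hgt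
      have e1 := v2 q hgt (by omega)
      have e2 := right q hgt (by omega)
      linarith
    have e2 := v1 q (by omega) hq
    have o : ∀ w, i + s + 1 + 1 < w → w < q → w ≠ p → False := fun w hw hw' hne => by
      have e3 := h4 w hw (by omega) hne (by omega)
      rw [v1 w (by omega) (by omega)] at e3
      have := h.anti (i := i + s + 1 + 1) (j := w) (k := q) hw (by omega) (by omega)
      linarith
    have hp2 : p = i + s + 1 + 2 := by
      by_contra hne
      exact o (i + s + 1 + 2) (by omega) (by omega) (by omega)
    have hq2 : q = i + s + 1 + 3 := by
      by_contra hne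
      exact o (i + s + 1 + 3) (by omega) (by omega) (by omega)
    subst hp2 hq2
    refine ⟨fun w hw hw' => v1 w hw (by omega), fun w hw hw' => v2 w (by omega) hw', ⟨?_, ?_⟩,
      fun w hw hw' => ?_, fun w hw hw' => ?_⟩
    · rw [h5, e1]; norm_num
    · rw [h6, e2]; norm_num
    · rw [h4 w (by omega) (by omega) (by omega) (by omega), v1 w (by omega) (by omega)]
    · rcases lt_or_ge w (i + s + 1 + n) with hlt' | hge
      · rw [h4 w (by omega) hlt' (by omega) (by omega), v2 w (by omega) hlt']
      · rw [show w = i + s + 1 + n by omega, h.last', cv]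
  refine ⟨s, hn, hs, tail, head, ?_⟩
  obtain ⟨-, -, ⟨t1, t2⟩, f1, f2⟩ := head
  obtain ⟨u, hu⟩ : ∃ u, u = i + s + 1 := ⟨_, rfl⟩
  rw [← hu] at t1 t2 f1 f2
  have hiu : i + (s + 3) = u + 2 := by omega
  rw [hiu]
  have m2 := hM (u + 2)
  have m3 := hM (u + 3)
  have p3 := h.pos (u + 3)
  rw [show u + 2 + 1 = u + 3 by ring] at m2
  rw [show u + 3 + 1 = u + 4 by ring] at m3 p3
  have c2 : A (u + 2) (u + 3) = 2 := by
    refine le_antisymm m2 ?_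
    rw [← t2, show u + 2 = u + 1 + 1 by ring]
    exact h.le_next (by omega) (by omega)
  have up : ∀ w, u + 2 < w → w < u + 2 + n → A (u + 2) w ≤ 2 := fun w hw hw' => by
    have := h.le_first hw hw'
    rw [show u + 2 + 1 = u + 3 by ring] at this
    exact this.trans m2
  -- An entry 1 cannot be raised by 2. The entry is -1 only if `s = 3`; then no bump fits before it,
  -- so monotonicity forces exactly one bump there.
  have key : A (u + 2) (u + 4) = 1 := by
    obtain ⟨p, q, h1, h2, h3, h4⟩ := h.bump (u + 1)
    rw [show u + 1 + 1 = u + 2 by ring, t1] at h4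
    have e1 := h4 (u + 4) (by omega) (by omega)
    have e2 := up (u + 4) (by omega) (by omega)
    rcases le_or_gt (u + 4) (u + s) with hle | hgt
    · rw [f1 _ (by omega) hle] at e1
      split_ifs at e1 <;> linarith
    · have e3 := h4 (u + 3) (by omega) (by omega)
      have e5 := h4 (u + 5) (by omega) (by omega)
      have e6 := up (u + 5) (by omega) (by omega)
      rw [f2 _ (by omega) (by omega)] at e1
      rw [f2 _ (by omega) (by omega)] at e5
      have e7 := h.anti (i := u + 2) (j := u + 4) (k := u + 5) (by omega) (by omega) (by omega)
      have hp : u + 3 ≠ p := by rintro rfl; simp at e3; split_ifs at e3 <;> linarith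
      have hp : u + 3 ≠ q := by rintro rfl; simp at e3; split_ifs at e3 <;> linarith
      have e8 := h4 p (by omega) (by omega)
      have e9 := up p (by omega) (by omega)
      have e10 := h.anti (i := u + 2) (j := u + 4) (k := p) (by omega) (by omega) (by omega)
      rw [f2 p (by omega) (by omega)] at e8
      split_ifs at e1 e8 <;> first | omega | linarith
  have c3 : A (u + 3) (u + 4) = 1 := by
    obtain ⟨p, q, h1, h2, h3, h4⟩ := h.bump (u + 2)
    rw [show u + 2 + 1 = u + 3 by ring, c2] at h4
    have e1 := h4 (u + 4) (by omega) (by omega)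
    rw [key] at e1
    split_ifs at e1 <;> linarith
  refine ⟨?_, ?_, ?_⟩
  · rw [show u + 2 - 1 = u + 1 by ring, t1]
  · rw [show u + 2 + 1 = u + 3 by ring, c2]
  · rw [show u + 2 + 1 = u + 3 by ring, show u + 2 + 2 = u + 4 by ring, c3]

theorem isZHead_periodic (h : CyclicBumps n A) (s i : ℤ) :
    IsZHead s n A (i + n) → IsZHead s n A i := by
  rintro ⟨h1, h2, h3, h4, h5⟩
  simp only [show i + n + 1 = i + 1 + n by ring, show i + n + 2 = i + 2 + n by ring,
    show i + n + 3 = i + 3 + n by ring, h.periodic_left, h.periodic] at *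
  have e : ∀ j w, A j (w + n) = A j w := h.periodic
  exact ⟨fun w hw hw' => by rw [← e]; exact h1 _ (by omega) (by omega),
    fun w hw hw' => by rw [← e]; exact h2 _ (by omega) (by omega), h3,
    fun w hw hw' => by rw [← e]; exact h4 _ (by omega) (by omega),
    fun w hw hw' => by rw [← e]; exact h5 _ (by omega) (by omega)⟩

/-- The drops are closed under shifts by `s + 3` and by `n = 2 s + 1`, hence by `2 (s + 3) - n = 5`.
The tail of a block comes from its own drop, the head from the preceding one. -/
theorem IsDrop.isX5At_or_isZAt (h : CyclicBumps n A) (hn : 4 ≤ n) (hM : ∀ i, A i (i + 1) ≤ 2)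
    (hR : ∀ i, A (i + 1) (i + 2) = A i (i + 1) ∨ A (i + 1) (i + 2) = 2 * A i (i + 1) ∨
      2 * A (i + 1) (i + 2) = A i (i + 1)) {i : ℤ} (hi : IsDrop A i) :
    (∃ j, n = 5 ∧ IsX5At A 1 j) ∨ ∃ j, IsZAt n A j := by
  by_cases hX : ∃ j, n = 5 ∧ IsX5At A 1 j
  · exact Or.inl hX
  right
  have step : ∀ i, IsDrop A i → ∃ s, n = 2 * s + 1 ∧ 3 ≤ s ∧ IsZTail s n A (i - 2) ∧
      IsZHead s n A (i + s + 1) ∧ IsDrop A (i + (s + 3)) := by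
    intro i hi
    obtain ⟨v, d⟩ := hi.exists_isDropAt h hn
    rcases d.anti.lt_or_eq with hlt | heq
    · exact (hX ⟨v, d.isX5At h hlt⟩).elim
    · exact d.isZ h hM heq (d.edge_le_one h hM hR heq)
  obtain ⟨s, hs, hs3, -⟩ := step i hi
  have step' : ∀ i, IsDrop A i → IsZTail s n A (i - 2) ∧
      IsZHead s n A (i + s + 1) ∧ IsDrop A (i + (s + 3)) := by
    intro i hi
    obtain ⟨s', hs', -, r⟩ := step i hi
    obtain rfl : s' = s := by omega
    exact r
  have cl : ∀ t m, IsDrop A (i + (s + 3) * t + n * m) := fun t m =>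
    periodic_closed (by omega) h.isDrop_periodic (fun j hj => (step' j hj).2.2) hi t m
  by_cases h5 : n % 5 = 0
  · refine ⟨i - 2, (s - 2) / 5, by omega, by omega, fun t => ?_⟩
    rw [show 5 * ((s - 2) / 5) + 2 = s by omega]
    constructor
    · apply h.isZHead_periodic
      have := (step' _ (cl (2 * t - 1) (1 - t))).2.1
      rwa [show i + (s + 3) * (2 * t - 1) + n * (1 - t) + s + 1 = i - 2 + 5 * t + n by
        rw [hs]; ring] at this
    · have := (step' _ (cl (2 * t) (- t))).1
      rwa [show i + (s + 3) * (2 * t) + n * -t - 2 = i - 2 + 5 * t by rw [hs]; ring] at this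
  -- If 5 does not divide `n`, the shifts by 5 and `n` generate a shift by 1, so the edge after a
  -- drop would be both 1 and 2.
  · exfalso
    have cl5 : ∀ a m, IsDrop A (i + 5 * a + n * m) := fun a m => by
      have := cl (2 * a) (m - a)
      rwa [show i + (s + 3) * (2 * a) + n * (m - a) = i + 5 * a + n * m by rw [hs]; ring] at this
    have bez : ∃ a m : ℤ, 5 * a + n * m = 1 := by
      have hr : n % 5 = 1 ∨ n % 5 = 2 ∨ n % 5 = 3 ∨ n % 5 = 4 := by omega
      rcases hr with hr | hr | hr | hr
      · exact ⟨-(n / 5), 1, by omega⟩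
      · exact ⟨1 - 3 * (n / 5) - 2, 3, by omega⟩
      · exact ⟨-1 - 2 * (n / 5), 2, by omega⟩
      · exact ⟨1 + n / 5, -1, by omega⟩
    obtain ⟨a, m, ham⟩ := bez
    have := cl5 a m
    rw [show i + 5 * a + n * m = i + 1 by omega] at this
    have e1 := this.2.1
    rw [show i + 1 + 1 = i + 2 by ring] at e1
    have := hi.2.2
    linarith

end CyclicBumps

/-! ### Equal edges, the matrices `C_{n,k,I}`, and the classification over the reals. -/

namespace CyclicBumps

variable {n : ℤ} {A : ℤ → ℤ → ℝ}

/-- Going down a column from the entry -1 below the diagonal, all bumps are 1, so the entries are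
integers, and monotonicity bounds them by 1 in absolute value. -/
theorem entry_of_const (h : CyclicBumps n A) (hc : ∀ i, A i (i + 1) = 1) {i j : ℤ} (h1 : i < j)
    (h2 : j < i + n) : A i j = 1 ∨ A i j = 0 ∨ A i j = -1 := by
  have int : ∀ v i : ℤ, v + 1 ≤ i → i < v + n → ∃ m : ℤ, A i (v + n) = m := by
    intro v i hi
    induction i, hi using Int.leInduction with
    | base => exact fun _ => ⟨-1, by rw [h.last', hc]; norm_num⟩
    | succ i hi ih =>
      intro hi'
      obtain ⟨m, hm⟩ := ih (by omega)
      obtain ⟨p, q, -, -, -, h4⟩ := h.bump i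
      refine ⟨m + ((if v + n = p then 1 else 0) + (if v + n = q then 1 else 0)), ?_⟩
      rw [h4 (v + n) hi' (by omega), hm, hc]
      push_cast
      ring
  obtain ⟨m, hm⟩ := int (j - n) i (by omega) (by omega)
  rw [show j - n + n = j by ring] at hm
  have e1 := h.le_first h1 h2
  have e2 := h.last_le h1 h2
  have e3 := hc (i - 1)
  rw [show i - 1 + 1 = i by ring] at e3
  rw [hc, hm] at e1
  rw [e3, hm] at e2
  have e4 : m ≤ 1 := by exact_mod_cast e1
  have e5 : -1 ≤ m := by exact_mod_cast e2
  rw [hm]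
  obtain rfl | rfl | rfl : m = 1 ∨ m = 0 ∨ m = -1 := by omega
  all_goals simp

theorem exists_length_of_const (h : CyclicBumps n A) (hc : ∀ i, A i (i + 1) = 1) (i : ℤ) :
    ∃ l : ℤ, 1 ≤ l ∧ 2 * l < n ∧ ∀ j, i < j → j < i + n →
      (A i j = 1 ↔ j ≤ i + l) ∧ (A i j = -1 ↔ i + n - l ≤ j) := by
  have hn := h.three_le
  obtain ⟨g, ⟨g1, g2, g3⟩, g4⟩ := Int.exists_greatest_of_bdd
    (P := fun j => i < j ∧ j < i + n ∧ A i j = 1) ⟨i + n, fun z hz => hz.2.1.le⟩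
    ⟨i + 1, by omega, by omega, hc i⟩
  obtain ⟨m, ⟨m1, m2, m3⟩, m4⟩ := Int.exists_least_of_bdd
    (P := fun j => i < j ∧ j < i + n ∧ A i j = -1) ⟨i, fun z hz => hz.1.le⟩
    ⟨i + n - 1, by omega, by omega, by rw [h.last]; have := hc (i - 1); simp at this; rw [this]⟩
  have hgm : g < m := by
    by_contra hle
    have := h.anti (i := i) (j := m) (k := g) m1 (by omega) g2
    rw [g3, m3] at this
    norm_num at this
  have a1 : ∀ j, i < j → j ≤ g → A i j = 1 := fun j hj hj' => by
    have e1 := h.anti hj hj' g2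
    have e2 := h.le_first hj (by omega)
    rw [hc] at e2
    linarith
  have a3 : ∀ j, m ≤ j → j < i + n → A i j = -1 := fun j hj hj' => by
    have e1 := h.anti m1 hj hj'
    rcases h.entry_of_const hc (show i < j by omega) hj' with e | e | e <;> linarith
  have a2 : ∀ j, g < j → j < m → A i j = 0 := fun j hj hj' => by
    rcases h.entry_of_const hc (show i < j by omega) (by omega) with e | e | e
    · have := g4 j ⟨by omega, by omega, e⟩; omega
    · exact e
    · have := m4 j ⟨by omega, by omega, e⟩; omega
  have hs := h.sum_tail i
  rw [sum_Ico_int_split _ (b := g + 1) (by omega) (by omega),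
    sum_Ico_int_split _ (a := g + 1) (b := m) (by omega) (by omega),
    sum_Ico_int_eq _ 1 (by omega) (fun j hj hj' => a1 j (by omega) (by omega)),
    sum_Ico_int_eq _ 0 (by omega) (fun j hj hj' => a2 j (by omega) (by omega)),
    sum_Ico_int_eq _ (-1) (by omega) a3] at hs
  push_cast at hs
  have he : g - i = i + n - m := by
    have : (g - i : ℝ) = i + n - m := by linarith
    exact_mod_cast this
  refine ⟨g - i, by omega, by omega, fun j hj hj' => ⟨⟨fun e => ?_, fun e => a1 j hj (by omega)⟩,
    ⟨fun e => ?_, fun e => a3 j (by omega) hj'⟩⟩⟩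
  · have := g4 j ⟨hj, hj', e⟩; omega
  · have := m4 j ⟨hj, hj', e⟩; omega

/-- The rows of the matrices `C_{n,k,I}`: the row `i` has `l i` ones after the diagonal and `l i`
minus ones before it. -/
def IsC (n : ℤ) (A : ℤ → ℤ → ℝ) : Prop :=
  ∃ (k : ℤ) (l : ℤ → ℤ), 1 ≤ k ∧ 2 * k < n ∧ (∀ i, l i = k ∨ l i = k - 1) ∧ (∀ i, 1 ≤ l i) ∧
    (∀ i, l (i + k) = l i) ∧ (∀ i, l (i + n) = l i) ∧ ∀ i j, i < j → j < i + n →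
      A i j = if j ≤ i + l i then 1 else if j < i + n - l i then 0 else -1

/-- Let `k` be the largest number of ones in a row. Skew symmetry (`hflip`) with `t = k` shows that
`l i = k` is invariant under a shift by `k`; with `t = k - 1` it keeps all other lengths from
falling below `k - 1`. -/
theorem isC_of_const (h : CyclicBumps n A) (hc : ∀ i, A i (i + 1) = 1) : IsC n A := by
  have hn := h.three_le
  choose l l1 l2 l3 using h.exists_length_of_const hc
  have per : ∀ i, l (i + n) = l i := by
    intro i
    have e1 := (l3 i (i + l i) (by have := l1 i; omega) (by have := l2 i; omega)).1.2 le_rfl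
    have e2 := (l3 (i + n) (i + l i + n) (by have := l1 i; omega) (by have := l2 i; omega)).1.1
      (by rw [h.periodic, h.periodic_left, e1])
    have e3 := (l3 (i + n) (i + l (i + n) + n) (by have := l1 (i + n); omega)
      (by have := l2 (i + n); omega)).1.2 (by omega)
    rw [h.periodic, h.periodic_left] at e3
    have e4 := (l3 i (i + l (i + n)) (by have := l1 (i + n); omega)
      (by have := l2 (i + n); omega)).1.1 e3
    omega
  have hflip : ∀ i t, 0 < t → t < n → (t ≤ l i ↔ t ≤ l (i + t)) := by
    intro i t ht ht'
    have e1 := (l3 i (i + t) (by omega) (by omega)).1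
    have e2 := (l3 (i + t) (i + n) (by omega) (by omega)).2
    rw [h.flip] at e2
    constructor
    · intro hle
      have := e2.1 (by rw [e1.2 (by omega)])
      omega
    · intro hle
      have := e2.2 (by omega)
      have := e1.1 (by linarith)
      omega
  obtain ⟨i₀, hmax⟩ := periodic_exists_max (by omega) per
  have hk1 := l1 i₀
  have hk2 := l2 i₀
  obtain ⟨k, hk⟩ : ∃ k, k = l i₀ := ⟨_, rfl⟩
  rw [← hk] at hk1 hk2 hmax
  have top : ∀ i, l i = k ↔ l (i + k) = k := by
    intro i
    have := hflip i k (by omega) (by omega)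
    have := hmax i
    have := hmax (i + k)
    omega
  -- The induction passes from `j + m + 1` to `j + m + k`: these indices differ by `k - 1`, and the
  -- second one is `m` places after `j + k`, where the length is again `k`.
  have low : ∀ m : ℕ, ∀ j, l j = k → k - 1 ≤ l (j + m) := by
    intro m
    induction m with
    | zero => intro j hj; simp; omega
    | succ m ih =>
      intro j hj
      by_contra hlt
      have e := ih (j + k) ((top j).1 hj)
      have := l1 (j + (m + 1 : ℕ))
      have e2 := hflip (j + (m + 1 : ℕ)) (k - 1) (by omega) (by omega)
      rw [show j + ((m + 1 : ℕ) : ℤ) + (k - 1) = j + k + m by push_cast; ring] at e2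
      omega
  have low' : ∀ i, k - 1 ≤ l i := by
    intro i
    have h0 : 0 ≤ i - i₀ + n * |i - i₀| := by
      have : -(i - i₀) ≤ |i - i₀| := neg_le_abs _
      nlinarith [abs_nonneg (i - i₀)]
    have := low (i - i₀ + n * |i - i₀|).toNat i₀ hk.symm
    rw [Int.toNat_of_nonneg h0, show i₀ + (i - i₀ + n * |i - i₀|) = i + n * |i - i₀| by ring,
      periodic_add_mul per] at this
    exact this
  refine ⟨k, l, hk1, hk2, fun i => ?_, l1, fun i => ?_, per, fun i j hj hj' => ?_⟩
  · have := hmax i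
    have := low' i
    omega
  · have := top i
    have := hmax i
    have := hmax (i + k)
    have := low' i
    have := low' (i + k)
    omega
  · obtain ⟨e1, e2⟩ := l3 i j hj hj'
    split_ifs with c1 c2
    · exact e1.2 c1
    · rcases h.entry_of_const hc hj hj' with e | e | e
      · exact (c1 (e1.1 e)).elim
      · exact e
      · have := e2.1 e; omega
    · exact e2.2 (by omega)

/-- Only one column is free, so both bumps of each of the two steps fall into it. -/
theorem edge_const_of_three (h : CyclicBumps 3 A) (i : ℤ) :
    A (i + 1) (i + 2) = A i (i + 1) := by
  obtain ⟨p, q, h1, h2, h3, h4⟩ := h.bump i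
  obtain ⟨p', q', h1', h2', h3', h4'⟩ := h.bump (i + 1)
  have e1 := h4 (i + 2) (by omega) (by omega)
  have e2 := h4' (i + 3) (by omega) (by omega)
  rw [show i + 1 + 1 = i + 2 by ring] at e2
  rw [h.flip, h.flip, if_pos (by omega), if_pos (by omega)] at e2
  rw [if_pos (by omega), if_pos (by omega)] at e1
  linarith

theorem classification (h : CyclicBumps n A) : ∃ r : ℝ, 0 < r ∧
    (IsC n (fun i j => r * A i j) ∨
      (n = 4 ∧ ∃ c i, 0 < c ∧ IsX4At (fun i j => r * A i j) c i) ∨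
      (n = 5 ∧ ∃ i, IsX5At (fun i j => r * A i j) 1 i) ∨
      (∃ i, IsYAt n (fun i j => r * A i j) i) ∨ ∃ i, IsZAt n (fun i j => r * A i j) i) := by
  have hn := h.three_le
  by_cases hconst : ∀ i, A (i + 1) (i + 2) = A i (i + 1)
  · have p0 := h.pos 0
    refine ⟨(A 0 (0 + 1))⁻¹, by positivity, Or.inl ((h.smul (by positivity)).isC_of_const ?_)⟩
    intro i
    have e : A i (i + 1) = A 0 (0 + 1) := by
      induction i using Int.induction_on with
      | zero => rfl
      | succ i ih => rw [← ih, ← hconst i]; congr 1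
      | pred i ih => rw [← ih, ← hconst (-i - 1)]; congr 1 <;> ring
    rw [e]
    exact inv_mul_cancel₀ p0.ne'
  have hn4 : 4 ≤ n := by
    by_contra hlt
    obtain rfl : n = 3 := by omega
    exact hconst h.edge_const_of_three
  rcases h.ratio_or_isX4At hn4 with hR | ⟨h4, c, i, hc, hX⟩
  swap
  · refine ⟨1, one_pos, Or.inr (Or.inl ⟨h4, c, i, hc, ?_⟩)⟩
    simpa using hX
  obtain ⟨i₀, hmax⟩ := periodic_exists_max (f := fun i => A i (i + 1)) (by omega) h.edge_periodic
  have p0 := h.pos i₀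
  obtain ⟨M, hM0⟩ : ∃ M, M = A i₀ (i₀ + 1) := ⟨_, rfl⟩
  simp only [← hM0] at hmax p0
  -- The end of a run of maximal edges; without one, the maximum would propagate around the whole
  -- cycle.
  have hdrop : ∃ i, A i (i + 1) = M ∧ A (i + 1) (i + 2) ≠ M := by
    by_contra! hcon
    have all : ∀ i, A i (i + 1) = M := fun i => by
      have := periodic_closed (P := fun i => A i (i + 1) = M) (n := n) (s := 1) (by omega)
        (fun i => by simp only [h.edge_periodic]) (fun j hj => by
          have := hcon j hj
          rwa [show j + 2 = j + 1 + 1 by ring] at this) hM0.symm (i - i₀) 0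
      rwa [show i₀ + 1 * (i - i₀) + n * 0 = i by ring] at this
    refine hconst fun i => ?_
    rw [all i, show i + 2 = i + 1 + 1 by ring, all]
  obtain ⟨i, hi, hi'⟩ := hdrop
  have hr : 0 < 2 / M := by positivity
  have h' := h.smul hr
  have hrM : 2 / M * M = 2 := by field_simp
  have hmax' : ∀ i, 2 / M * A i (i + 1) ≤ 2 := fun i => by
    exact (mul_le_mul_of_nonneg_left (hmax i) hr.le).trans hrM.le
  have hR' : ∀ i, 2 / M * A (i + 1) (i + 2) = 2 / M * A i (i + 1) ∨
      2 / M * A (i + 1) (i + 2) = 2 * (2 / M * A i (i + 1)) ∨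
      2 * (2 / M * A (i + 1) (i + 2)) = 2 / M * A i (i + 1) := fun i => by
    rcases hR i with r | r | r
    · left; rw [r]
    · right; left; rw [r.1]; ring
    · right; right; rw [← r.1]; ring
  have c1 : 2 / M * A i (i + 1) = 2 := by rw [hi, hrM]
  have c2 : 2 / M * A (i + 1) (i + 2) = 1 := by
    rcases hR i with r | r | r
    · exact (hi' (r.trans hi)).elim
    · have := hmax (i + 1)
      rw [show i + 1 + 1 = i + 2 by ring] at this
      have := h.pos i
      linarith [r.1]
    · have e : A (i + 1) (i + 2) = M / 2 := by linarith [r.1]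
      rw [e]; field_simp
  refine ⟨2 / M, hr, Or.inr (Or.inr ?_)⟩
  have e := hR' (i - 1)
  rw [show i - 1 + 1 = i by ring, show i - 1 + 2 = i + 1 by ring, c1] at e
  have m0 := hmax' (i - 1)
  rw [show i - 1 + 1 = i by ring] at m0
  rcases e with e | e | e
  · rcases IsDrop.isX5At_or_isZAt h' hn4 hmax' hR' (i := i) ⟨e.symm, c1, c2⟩ with
      ⟨j, h5, hX⟩ | ⟨j, hZ⟩
    · exact Or.inl ⟨h5, j, hX⟩
    · exact Or.inr (Or.inr ⟨j, hZ⟩)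
  · exact Or.inr (Or.inl ⟨i, IsPeak.isYAt h' hn4 hmax' ⟨by linarith, c1, c2⟩⟩)
  · exfalso; linarith

end CyclicBumps

/-! ### From a full smoothable cycle to a real matrix with bumps. -/

/-- A numbering of the indices along a full smoothable cycle, extended periodically to the
integers. -/
structure CyclicNumbering {n : ℕ} (B : Matrix (Fin n) (Fin n) ℂ) (u : ℤ → Fin n) : Prop where
  three_le : 3 ≤ n
  periodic : ∀ i, u (i + n) = u i
  dvd : ∀ i j, u i = u j → (n : ℤ) ∣ i - j
  smoothable : ∀ i, IsSmoothable B (u i) (u (i + 1))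

theorem hasFullSmoothableCycle_iff {n : ℕ} (B : Matrix (Fin n) (Fin n) ℂ)
    (hB : B.transpose = -B) : HasFullSmoothableCycle B hB ↔ ∃ u, CyclicNumbering B u := by
  constructor
  · rintro ⟨v, p, hp⟩
    have hlen : p.length = n := by rw [hp.length_eq, Fintype.card_fin]
    have h3 : 3 ≤ n := hlen ▸ hp.isCycle.three_le_length
    have hn : (0 : ℤ) < n := by omega
    have hmod : ∀ i : ℤ, 0 ≤ i % n ∧ i % n < n := fun i =>
      ⟨Int.emod_nonneg _ (by omega), Int.emod_lt_of_pos _ hn⟩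
    refine ⟨fun i => p.getVert (i % n).toNat, h3, fun i => by simp, fun i j hij => ?_, fun i => ?_⟩
    · have hi := hmod i
      have hj := hmod j
      have := hp.isCycle.getVert_injOn' (show (i % n).toNat ∈ _ by
        simp only [Set.mem_ofPred_eq]; omega) (show (j % n).toNat ∈ _ by
        simp only [Set.mem_ofPred_eq]; omega) hij
      exact Int.ModEq.dvd (show j % n = i % n by omega)
    · have hi := hmod i
      have hadj := p.adj_getVert_succ (i := (i % n).toNat) (by omega)
      have e : p.getVert ((i % n).toNat + 1) = p.getVert ((i + 1) % n).toNat := by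
        rcases eq_or_ne (i % n) (n - 1) with h | h
        · have h1 : (i + 1) % n = 0 := by
            rw [Int.add_emod, h, Int.emod_eq_of_lt (a := 1) (by omega) (by omega)]; simp
          rw [h1, show (i % n).toNat + 1 = p.length by omega]
          simp
        · have h1 : (i + 1) % n = i % n + 1 := by
            rw [Int.add_emod, Int.emod_eq_of_lt (a := 1) (by omega) (by omega),
              Int.emod_eq_of_lt (by omega) (by omega)]
          rw [h1]
          congr 1
          omega
      rw [e] at hadj
      exact hadj
  · rintro ⟨u, h3, hper, hdvd, hsm⟩
    obtain ⟨m, rfl⟩ : ∃ m, n = m + 3 := ⟨n - 3, by omega⟩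
    have hcast : ∀ x y : Fin (m + 3), (y - x).val = 1 → u (y : ℕ) = u ((x : ℕ) + 1) := by
      intro x y h
      have hy : y = x + 1 := by
        have : y - x = 1 := Fin.ext (by rw [h]; rfl)
        exact sub_eq_iff_eq_add'.1 this
      rw [hy, Fin.val_add]
      have h1 : ((1 : Fin (m + 3)) : ℕ) = 1 := rfl
      rw [h1]
      rcases Nat.lt_or_ge ((x : ℕ) + 1) (m + 3) with hlt | hge
      · rw [Nat.mod_eq_of_lt hlt]; push_cast; rfl
      · have hx := x.isLt
        have : (x : ℕ) + 1 = m + 3 := by omega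
        rw [this, Nat.mod_self]
        have h2 := hper 0
        rw [zero_add] at h2
        rw [show ((x : ℕ) : ℤ) + 1 = ((m + 3 : ℕ) : ℤ) by omega, h2]
        rfl
    let f : SimpleGraph.cycleGraph (m + 3) →g smoothableGraph B hB :=
      { toFun := fun x => u (x : ℕ)
        map_rel' := by
          intro x y hxy
          rw [SimpleGraph.cycleGraph_adj'] at hxy
          rcases hxy with h | h
          · have := hsm (y : ℕ)
            rw [← hcast y x h] at this
            exact this.symm hB
          · have := hsm (x : ℕ)
            rw [← hcast x y h] at this
            exact this }
    have hf : Function.Injective f := by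
      intro x y hxy
      have h := hdvd _ _ hxy
      have hx := x.isLt
      have hy := y.isLt
      have := Int.eq_zero_of_abs_lt_dvd h (by rw [abs_lt]; omega)
      exact Fin.ext (by omega)
    have hc : (SimpleGraph.cycleGraph.cycle m).IsHamiltonianCycle := by
      rw [SimpleGraph.Walk.isHamiltonianCycle_iff_isCycle_and_length_eq]
      exact ⟨SimpleGraph.cycleGraph.isCycle_cycle, by simp⟩
    exact ⟨_, _, hc.map (f := f) (Finite.injective_iff_bijective.1 hf)⟩

/-- A family of natural numbers with sum two consists of two ones (possibly in the same place). -/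
theorem exists_pair_of_sum_eq_two (s : Finset ℤ) (f : ℤ → ℕ) (hf : ∑ v ∈ s, f v = 2) :
    ∃ p ∈ s, ∃ q ∈ s, p ≤ q ∧
      ∀ v ∈ s, f v = (if v = p then 1 else 0) + (if v = q then 1 else 0) := by
  obtain ⟨p, hp, hp0⟩ := Finset.exists_ne_zero_of_sum_ne_zero (by rw [hf]; norm_num : ∑ v ∈ s, f v ≠ 0)
  have hf' : ∑ v ∈ s, (f v - if v = p then 1 else 0) = 1 := by
    rw [Finset.sum_tsub_distrib s (fun v _ => by split_ifs with h <;> [subst h; skip] <;> omega), hf,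
      Finset.sum_ite_eq' s p, if_pos hp]
  obtain ⟨q, hq, hq0⟩ := Finset.exists_ne_zero_of_sum_ne_zero
    (by rw [hf']; norm_num : ∑ v ∈ s, (f v - if v = p then 1 else 0) ≠ 0)
  have key : ∀ v ∈ s, f v = (if v = p then 1 else 0) + (if v = q then 1 else 0) := by
    intro v hv
    by_cases hvq : v = q
    · subst hvq
      have := Finset.single_le_sum (f := fun v => f v - if v = p then 1 else 0)
        (fun _ _ => Nat.zero_le _) hv
      simp only [hf'] at this
      split_ifs at * <;> omega
    · have h2 := Finset.sum_le_sum_of_subset (f := fun v => f v - if v = p then 1 else 0)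
        (show {v, q} ⊆ s by intro x hx; simp at hx; rcases hx with rfl | rfl <;> assumption)
      rw [Finset.sum_pair hvq, hf'] at h2
      by_cases hvp : v = p
      · subst hvp; simp [hvq] at *; omega
      · simp [hvq, hvp] at *; omega
  rcases le_total p q with h | h
  · exact ⟨p, hp, q, hq, h, key⟩
  · exact ⟨q, hq, p, hp, h, fun v hv => by rw [key v hv, add_comm]⟩

namespace CyclicNumbering

variable {n : ℕ} {B : Matrix (Fin n) (Fin n) ℂ} {u : ℤ → Fin n}

theorem sum_eq (hu : CyclicNumbering B u) (f : Fin n → ℂ) (i : ℤ) :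
    ∑ j ∈ Finset.Ico i (i + n), f (u j) = ∑ x, f x := by
  have hinj : Set.InjOn u (Finset.Ico i (i + n)) := by
    intro a ha b hb hab
    simp only [Finset.coe_Ico, Set.mem_Ico] at ha hb
    have := Int.eq_zero_of_abs_lt_dvd (hu.dvd _ _ hab) (by rw [abs_lt]; omega)
    omega
  rw [← Finset.sum_image hinj]
  congr 1
  apply Finset.eq_univ_of_card
  rw [Finset.card_image_of_injOn hinj]
  simp

theorem exists_bump (hB : B.transpose = -B) (hrow : ∀ i, ∑ j, B i j = 0)
    (hu : CyclicNumbering B u) (i : ℤ) :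
    ∃ p q, i + 1 < p ∧ p ≤ q ∧ q < i + n ∧ ∀ v, i + 1 < v → v < i + n →
      B (u (i + 1)) (u v) = B (u i) (u v) + B (u i) (u (i + 1)) *
        (((if v = p then 1 else 0) + (if v = q then 1 else 0) : ℕ) : ℂ) := by
  have h3 := hu.three_le
  have hs : ∀ a b, B a b = -B b a := fun a b => congrFun (congrFun hB b) a
  have hd : ∀ a, B a a = 0 := fun a => self_eq_neg.mp (hs a a)
  obtain ⟨hne, hq⟩ := hu.smoothable i
  have hm : ∀ v, ∃ m : ℕ, i + 1 < v → v < i + n →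
      B (u (i + 1)) (u v) = B (u i) (u v) + B (u i) (u (i + 1)) * m := by
    intro v
    by_cases hv : i + 1 < v ∧ v < i + n
    · obtain ⟨m, hm⟩ := hq (u v)
        (fun e => by
          have := Int.eq_zero_of_abs_lt_dvd (hu.dvd _ _ e) (by rw [abs_lt]; omega)
          omega)
        (fun e => by
          have := Int.eq_zero_of_abs_lt_dvd (hu.dvd _ _ e) (by rw [abs_lt]; omega)
          omega)
      refine ⟨m, fun _ _ => ?_⟩
      rw [← hm, mul_div_cancel₀ _ hne, hs (u v) (u i)]
      ring
    · exact ⟨0, fun h1 h2 => (hv ⟨h1, h2⟩).elim⟩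
  choose m hm using hm
  have hsplit : ∀ f : ℤ → ℂ, ∑ j ∈ Finset.Ico i (i + n), f j =
      f i + f (i + 1) + ∑ j ∈ Finset.Ico (i + 2) (i + n), f j := by
    intro f
    have : Finset.Ico i (i + n) = insert i (insert (i + 1) (Finset.Ico (i + 2) (i + n))) := by
      ext x; simp; omega
    rw [this, Finset.sum_insert (by simp), Finset.sum_insert (by simp)]
    ring
  have s1 := hsplit fun j => B (u i) (u j)
  have s2 := hsplit fun j => B (u (i + 1)) (u j)
  rw [hu.sum_eq (fun x => B (u i) x), hrow] at s1
  rw [hu.sum_eq (fun x => B (u (i + 1)) x), hrow] at s2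
  rw [Finset.sum_congr rfl (fun j hj => hm j (by simp at hj; omega) (by simp at hj; omega)),
    Finset.sum_add_distrib, ← Finset.mul_sum] at s2
  simp only [hd] at s1 s2
  rw [hs (u (i + 1)) (u i)] at s2
  -- Outside the columns `i` and `i + 1`, row `i + 1` sums to the edge and row `i` to minus the
  -- edge, so the bumps add up to twice the edge.
  have hsum : ∑ v ∈ Finset.Ico (i + 2) (i + n), m v = 2 := by
    have : B (u i) (u (i + 1)) * ∑ v ∈ Finset.Ico (i + 2) (i + n), (m v : ℂ) =
        B (u i) (u (i + 1)) * 2 := by linear_combination s1 - s2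
    have := mul_left_cancel₀ hne this
    exact_mod_cast this
  obtain ⟨p, hp, q, hq, hpq, hmv⟩ := exists_pair_of_sum_eq_two _ _ hsum
  rw [Finset.mem_Ico] at hp hq
  refine ⟨p, q, by omega, hpq, hq.2, fun v h1 h2 => ?_⟩
  rw [hm v h1 h2, hmv v (Finset.mem_Ico.2 ⟨by omega, h2⟩)]

theorem edge_ratio (hB : B.transpose = -B) (hrow : ∀ i, ∑ j, B i j = 0)
    (hu : CyclicNumbering B u) (i : ℤ) :
    ∃ r : ℝ, 0 < r ∧ B (u (i + 1)) (u (i + 2)) = B (u i) (u (i + 1)) * r := by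
  have h3 := hu.three_le
  have hs : ∀ a b, B a b = -B b a := fun a b => congrFun (congrFun hB b) a
  obtain ⟨p, q, -, -, -, h4⟩ := hu.exists_bump hB hrow i
  obtain ⟨p', q', -, -, -, h4'⟩ := hu.exists_bump hB hrow (i + 1)
  have e1 := h4 (i + 2) (by omega) (by omega)
  have e2 := h4' (i + n) (by omega) (by omega)
  rw [show i + 1 + 1 = i + 2 by ring, hu.periodic, hs (u (i + 2)), hs (u (i + 1)) (u i)] at e2
  generalize ((if i + 2 = p then 1 else 0) + (if i + 2 = q then 1 else 0) : ℕ) = a at e1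
  generalize ((if i + n = p' then 1 else 0) + (if i + n = q' then 1 else 0) : ℕ) = b at e2
  refine ⟨(1 + a) / (1 + b), by positivity, ?_⟩
  have hb : (1 + (b : ℂ)) ≠ 0 := by
    rw [add_comm]; exact Nat.cast_add_one_ne_zero b
  push_cast
  rw [← mul_div_assoc, eq_div_iff hb]
  linear_combination e1 - e2

/-- Scaling by the edge at 0 makes all edges real and positive, since consecutive ones have a
positive ratio. All other entries are reached from the diagonal by adding bumps. -/
theorem exists_cyclicBumps (hB : B.transpose = -B) (hrow : ∀ i, ∑ j, B i j = 0)
    (hu : CyclicNumbering B u) : ∃ (c : ℂ) (A : ℤ → ℤ → ℝ), c ≠ 0 ∧ CyclicBumps n A ∧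
      ∀ i j, B (u i) (u j) = c * A i j := by
  have h3 := hu.three_le
  have hs : ∀ a b, B a b = -B b a := fun a b => congrFun (congrFun hB b) a
  have hd : ∀ a, B a a = 0 := fun a => self_eq_neg.mp (hs a a)
  have hc : B (u 0) (u (0 + 1)) ≠ 0 := (hu.smoothable 0).1
  obtain ⟨c, hc0⟩ : ∃ c, c = B (u 0) (u (0 + 1)) := ⟨_, rfl⟩
  rw [← hc0] at hc
  have edge : ∀ i, ∃ r : ℝ, 0 < r ∧ B (u i) (u (i + 1)) = c * r := by
    intro i
    induction i using Int.induction_on with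
    | zero => exact ⟨1, one_pos, by rw [← hc0]; simp⟩
    | succ i ih =>
      obtain ⟨r, hr, e⟩ := ih
      obtain ⟨s, hs, e'⟩ := hu.edge_ratio hB hrow i
      refine ⟨r * s, by positivity, ?_⟩
      rw [show (i : ℤ) + 1 + 1 = i + 2 by ring, e', e]
      push_cast; ring
    | pred i ih =>
      obtain ⟨r, hr, e⟩ := ih
      obtain ⟨s, hs, e'⟩ := hu.edge_ratio hB hrow (-(i : ℤ) - 1)
      refine ⟨r / s, by positivity, ?_⟩
      rw [show -(i : ℤ) - 1 + 1 = -i by ring, show -(i : ℤ) - 1 + 2 = -i + 1 by ring, e] at e'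
      have hs' : (s : ℂ) ≠ 0 := by exact_mod_cast hs.ne'
      rw [show -(i : ℤ) - 1 + 1 = -i by ring]
      push_cast
      field_simp
      rw [← e']
  -- The column `v` is followed through the rows `v, …, v + n - 1`; its first step is skew symmetry,
  -- the later ones are bumps in the column `v + n`.
  have real : ∀ v i : ℤ, v ≤ i → i < v + n →
      ∃ r : ℝ, B (u i) (u v) = c * r := by
    intro v i hi
    induction i, hi using Int.leInduction with
    | base => exact fun _ => ⟨0, by simp [hd]⟩
    | succ i hi ih =>
      intro hi'
      rcases hi.eq_or_lt with rfl | hlt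
      · obtain ⟨r, -, e⟩ := edge v
        exact ⟨-r, by rw [hs, e]; push_cast; ring⟩
      · obtain ⟨r, e⟩ := ih (by omega)
        obtain ⟨s, -, e'⟩ := edge i
        obtain ⟨p, q, -, -, -, h4⟩ := hu.exists_bump hB hrow i
        have := h4 (v + n) (by omega) (by omega)
        rw [hu.periodic, e, e'] at this
        generalize ((if v + n = p then 1 else 0) + (if v + n = q then 1 else 0) : ℕ) = a at this
        exact ⟨r + s * a, by rw [this]; push_cast; ring⟩
  have real' : ∀ i j : ℤ, ∃ r : ℝ, B (u i) (u j) = c * r := by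
    intro i j
    have h1 := periodic_add_mul hu.periodic j ((i - j) / n)
    have h2 := Int.emod_add_mul_ediv (i - j) n
    have h4 := Int.emod_nonneg (i - j) (show (n : ℤ) ≠ 0 by omega)
    have h5 := Int.emod_lt_of_pos (i - j) (show (0 : ℤ) < n by omega)
    rw [← h1]
    exact real _ _ (by linarith) (by linarith)
  choose A hA using real'
  have inj : ∀ x y : ℝ, c * x = c * y → x = y := fun x y h => by
    exact_mod_cast mul_left_cancel₀ hc h
  refine ⟨_, A, hc, ⟨by omega, fun i j => inj _ _ ?_, fun i j => inj _ _ ?_, fun i => ?_,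
    fun i => ?_, fun i => inj _ _ ?_⟩, hA⟩
  · push_cast
    rw [mul_neg, ← hA, ← hA, hs]
  · rw [← hA, ← hA, hu.periodic]
  · obtain ⟨r, hr, e⟩ := edge i
    rw [hA] at e
    rwa [inj _ _ e]
  · obtain ⟨p, q, h1, h2, h5, h4⟩ := hu.exists_bump hB hrow i
    refine ⟨p, q, h1, h2, h5, fun v hv hv' => inj _ _ ?_⟩
    have := h4 v hv hv'
    simp only [hA] at this
    rw [this]
    split_ifs <;> push_cast <;> ring
  · push_cast
    rw [Finset.mul_sum]
    simp only [← hA]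
    rw [hu.sum_eq (fun x => B (u i) x), hrow]
    simp

end CyclicNumbering

/-! ### Finite matrices described on a cyclic window of columns. -/

/-- The residue class of an integer, as an index. -/
def finOfInt (n : ℕ) [NeZero n] (a : ℤ) : Fin n :=
  ⟨(a % n).toNat, by
    have hn : (0 : ℤ) < n := by exact_mod_cast NeZero.pos n
    have := Int.emod_nonneg a hn.ne'
    have := Int.emod_lt_of_pos a hn
    omega⟩

section finOfInt

variable {n : ℕ} [NeZero n]

theorem coe_finOfInt (a : ℤ) : ((finOfInt n a : ℕ) : ℤ) = a % n := by
  have hn : (n : ℤ) ≠ 0 := by exact_mod_cast NeZero.ne n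
  exact Int.toNat_of_nonneg (Int.emod_nonneg a hn)

theorem finOfInt_eq_iff {a b : ℤ} : finOfInt n a = finOfInt n b ↔ a % n = b % n := by
  rw [← coe_finOfInt, ← coe_finOfInt, Fin.ext_iff]
  omega

theorem finOfInt_coe (x : Fin n) : finOfInt n ((x : ℕ) : ℤ) = x := by
  apply Fin.ext
  have := coe_finOfInt (n := n) ((x : ℕ) : ℤ)
  rw [Int.emod_eq_of_lt (by omega) (by omega)] at this
  omega

theorem finOfInt_add_mul (a m : ℤ) : finOfInt n (a + n * m) = finOfInt n a := by
  rw [finOfInt_eq_iff]; simp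

theorem coe_finOfInt_of_lt {a : ℤ} (h0 : 0 ≤ a) (h1 : a < n) :
    ((finOfInt n a : ℕ) : ℤ) = a := by
  rw [coe_finOfInt, Int.emod_eq_of_lt h0 h1]

theorem finRotate_finOfInt (a : ℤ) : finRotate n (finOfInt n a) = finOfInt n (a + 1) := by
  obtain ⟨m, rfl⟩ : ∃ m, n = m + 1 := ⟨n - 1, by have := NeZero.pos n; omega⟩
  rw [finRotate_apply, ← finOfInt_coe (finOfInt (m + 1) a + 1), finOfInt_eq_iff, Fin.val_add,
    Fin.val_one']
  push_cast
  rw [coe_finOfInt]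
  push_cast
  simp

theorem cyclicShift_iterate_finOfInt (m : ℕ) (r : Fin n → ℤ) (b : ℤ) :
    (cyclicShift^[m] r) (finOfInt n b) = r (finOfInt n (b - m)) := by
  induction m generalizing b with
  | zero => simp
  | succ m ih =>
    rw [Function.iterate_succ_apply']
    have : (finRotate n).symm (finOfInt n b) = finOfInt n (b - 1) := by
      rw [Equiv.symm_apply_eq, finRotate_finOfInt]; congr 1; ring
    unfold cyclicShift at ih ⊢
    rw [this, ih]
    congr 2
    push_cast; ring

/-- The matrix `M` has zeros on the diagonal, and `E` gives its other entries, the columns being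
counted cyclically from the diagonal on. -/
def Represents (M : Matrix (Fin n) (Fin n) ℤ) (E : ℤ → ℤ → ℤ) : Prop :=
  (∀ x, M x x = 0) ∧ ∀ a b : ℤ, a < b → b < a + n → M (finOfInt n a) (finOfInt n b) = E a b

/-- For a description that is invariant under the diagonal shift by the period it suffices to look
at the rows with index in `[0, n)`. -/
theorem represents_of_nonneg {M : Matrix (Fin n) (Fin n) ℤ} {E : ℤ → ℤ → ℤ}
    (hE : ∀ a b, E (a + n) (b + n) = E a b) (hd : ∀ x, M x x = 0)
    (h : ∀ a : ℕ, ∀ ha : a < n, ∀ b : ℤ, a < b → b < a + n →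
      M ⟨a, ha⟩ (finOfInt n b) = E a b) : Represents M E := by
  refine ⟨hd, fun a b hab hba => ?_⟩
  have e1 := Int.emod_add_mul_ediv a n
  have hn : (0 : ℤ) < n := by exact_mod_cast NeZero.pos n
  have e2 := Int.emod_nonneg a hn.ne'
  have e3 := Int.emod_lt_of_pos a hn
  have hE' : ∀ m : ℤ, E (a + n * m) (b + n * m) = E a b := by
    intro m
    have := periodic_add_mul (f := fun t => E (a + t) (b + t)) (n := n)
      (fun i => by rw [← add_assoc, ← add_assoc, hE]) 0 m
    simpa using this
  have := h (a % n).toNat (by omega) (b + n * (-(a / n))) (by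
    rw [Int.toNat_of_nonneg e2]; linarith) (by rw [Int.toNat_of_nonneg e2]; linarith)
  rw [finOfInt_add_mul, Int.toNat_of_nonneg e2] at this
  rw [← hE' (-(a / n)), show a + n * -(a / n) = a % n by linarith, ← this]
  rfl

end finOfInt

theorem IsProjEquiv.eq_size {n m : ℕ} {B : Matrix (Fin n) (Fin n) ℂ}
    {M : Matrix (Fin m) (Fin m) ℤ} (h : IsProjEquiv B M) : n = m := by
  obtain ⟨σ, -⟩ := h
  simpa using Fintype.card_congr σ

theorem CyclicNumbering.isProjEquiv {n : ℕ} {B : Matrix (Fin n) (Fin n) ℂ} {u : ℤ → Fin n}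
    (hu : CyclicNumbering B u) {M : Matrix (Fin n) (Fin n) ℤ} {c : ℂ} (hc : c ≠ 0) (i : ℤ)
    (h : ∀ x y : Fin n, B (u (i + (x : ℕ))) (u (i + (y : ℕ))) = c * M x y) : IsProjEquiv B M := by
  have hinj : Function.Injective fun x : Fin n => u (i + (x : ℕ)) := by
    intro x y hxy
    have hx := x.isLt
    have hy := y.isLt
    have := Int.eq_zero_of_abs_lt_dvd (hu.dvd _ _ hxy) (by rw [abs_lt]; omega)
    exact Fin.ext (by omega)
  refine ⟨(Equiv.ofBijective _ (Finite.injective_iff_bijective.1 hinj)).symm, c, hc,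
    fun a b => ?_⟩
  have e := Equiv.ofBijective_apply_symm_apply _ (Finite.injective_iff_bijective.1 hinj)
  rw [← h]
  congr 1
  · exact (e a).symm
  · exact (e b).symm

theorem CyclicNumbering.isProjEquiv_of_represents {n : ℕ} [NeZero n]
    {B : Matrix (Fin n) (Fin n) ℂ} {u : ℤ → Fin n} (hu : CyclicNumbering B u) {c : ℂ} (hc : c ≠ 0)
    {A : ℤ → ℤ → ℝ} (hA : CyclicBumps n A) (hBA : ∀ i j, B (u i) (u j) = c * A i j)
    {M : Matrix (Fin n) (Fin n) ℤ} {E : ℤ → ℤ → ℤ} (hM : Represents M E) {r : ℝ} (hr : 0 < r)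
    (i : ℤ) (h : ∀ a b : ℤ, a < b → b < a + n → r * A (i + a) (i + b) = E a b) : IsProjEquiv B M := by
  have hr' : (r : ℂ) ≠ 0 := by exact_mod_cast hr.ne'
  refine hu.isProjEquiv (c := c / r) (div_ne_zero hc hr') i fun x y => ?_
  have hx := x.isLt
  have hy := y.isLt
  have key : r * A (i + (x : ℕ)) (i + (y : ℕ)) = M x y := by
    rcases lt_trichotomy x y with hlt | rfl | hgt
    · rw [h _ _ (by exact_mod_cast hlt) (by omega), ← hM.2 _ _ (by exact_mod_cast hlt) (by omega),
        finOfInt_coe, finOfInt_coe]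
    · rw [hA.diag, hM.1]; simp
    · have hgt' : (y : ℕ) < (x : ℕ) := hgt
      rw [← hA.periodic, add_assoc, h _ _ (by omega) (by omega), ← hM.2 _ _ (by omega) (by omega),
        finOfInt_coe, show ((y : ℕ) : ℤ) + n = (y : ℕ) + n * 1 by ring, finOfInt_add_mul,
        finOfInt_coe]
  rw [hBA]
  have key' : (r : ℂ) * A (i + (x : ℕ)) (i + (y : ℕ)) = M x y := by exact_mod_cast key
  rw [← key']
  field_simp

/-- The cyclic order of the indices of `M` is itself the cycle. Any third index has a representative
between `i + 1` and `i + n`, where `E` compares the two rows. -/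
theorem IsProjEquiv.hasFullSmoothableCycle {n : ℕ} [NeZero n] (hn : 3 ≤ n)
    {B : Matrix (Fin n) (Fin n) ℂ} (hB : B.transpose = -B)
    {M : Matrix (Fin n) (Fin n) ℤ} {E : ℤ → ℤ → ℤ} (hM : Represents M E)
    (h0 : ∀ a, E a (a + 1) ≠ 0)
    (h : ∀ a b : ℤ, a + 1 < b → b < a + n → ∃ m : ℕ, E (a + 1) b - E a b = E a (a + 1) * m)
    (hBM : IsProjEquiv B M) : HasFullSmoothableCycle B hB := by
  obtain ⟨σ, c, hc, hσ⟩ := hBM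
  rw [hasFullSmoothableCycle_iff]
  have hs : ∀ a b, B a b = -B b a := fun a b => congrFun (congrFun hB b) a
  have hB' : ∀ a b, B (σ.symm (finOfInt n a)) (σ.symm (finOfInt n b)) =
      c * M (finOfInt n a) (finOfInt n b) := fun a b => by rw [hσ]; simp
  refine ⟨fun i => σ.symm (finOfInt n i), hn, fun i => ?_, fun i j hij => ?_, fun i => ⟨?_, ?_⟩⟩
  · have := finOfInt_add_mul (n := n) i 1
    rw [mul_one] at this
    rw [this]
  · have := finOfInt_eq_iff.1 (σ.symm.injective hij)
    exact Int.ModEq.dvd this.symm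
  · rw [hB', hM.2 _ _ (by omega) (by omega)]
    exact mul_ne_zero hc (by exact_mod_cast h0 i)
  · intro k hki hki1
    obtain ⟨b, hb1, hb2, hbk⟩ : ∃ b : ℤ, i ≤ b ∧ b < i + n ∧ finOfInt n b = σ k := by
      refine ⟨i + ((σ k : ℕ) - i) % n, ?_, ?_, ?_⟩
      · have := Int.emod_nonneg ((σ k : ℕ) - i : ℤ) (show (n : ℤ) ≠ 0 by omega); omega
      · have := Int.emod_lt_of_pos ((σ k : ℕ) - i : ℤ) (show (0 : ℤ) < n by omega); omega
      · refine (finOfInt_eq_iff.2 ?_).trans (finOfInt_coe (σ k))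
        simp
    have hk : k = σ.symm (finOfInt n b) := by rw [hbk]; simp
    subst hk
    have hb3 : b ≠ i := fun e => hki (by rw [e])
    have hb4 : b ≠ i + 1 := fun e => hki1 (by rw [e])
    obtain ⟨m, hm⟩ := h i b (by omega) hb2
    refine ⟨m, ?_⟩
    have h0' : (E i (i + 1) : ℂ) ≠ 0 := by exact_mod_cast h0 i
    have hm' : (E (i + 1) b - E i b : ℂ) = E i (i + 1) * m := by exact_mod_cast hm
    rw [hs (σ.symm (finOfInt n b)), hB', hB', hB', hM.2 _ _ (by omega) (by omega),
      hM.2 _ _ (by omega) (by omega), hM.2 _ _ (by omega) (by omega), div_eq_iff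
      (mul_ne_zero hc h0')]
    linear_combination c * hm'

/-! ### Entries of `C_{n,k,I}`, `Y_n` and `Z_n`, counted from the diagonal. -/

section Entries

/-- The entries of the matrix `C_{n,k,I}`, where `l i` is the number of ones in the row `i`. -/
def entryC (n : ℤ) (l : ℤ → ℤ) (a b : ℤ) : ℤ :=
  if b ≤ a + l a then 1 else if b < a + n - l a then 0 else -1

/-- The entries of the matrix `Y_n`, for `n = 2 m`. -/
def entryY (m a b : ℤ) : ℤ :=
  if a % 2 = 0 then
    if b = a + 1 then 2 else if b < a + m then 1 else -1
  else
    if b ≤ a + m then 1 else if b < a + 2 * m - 1 then -1 else -2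

/-- The entries of the matrix `Z_n`, for `n = 2 s + 1`. -/
def entryZ (s a b : ℤ) : ℤ :=
  if a % 5 = 0 then
    if b ≤ a + s then 1 else -1
  else if a % 5 = 1 then
    if b ≤ a + 2 then 2 else if b < a + s then 1 else -1
  else if a % 5 = 2 then
    if b ≤ a + 1 then 2 else if b ≤ a + s then 1 else if b < a + 2 * s then -1 else -2
  else if a % 5 = 3 then
    if b ≤ a + s + 1 then 1 else if b < a + 2 * s - 1 then -1 else -2
  else
    if b ≤ a + s then 1 else -1

theorem represents_matrixC {n k : ℕ} [NeZero n] (I : Fin (Nat.gcd n k) → Fin 2)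
    (h2k : 2 * k < n) (l : ℤ → ℤ)
    (hl : ∀ (a : ℤ) (s : Fin (Nat.gcd n k)), ((s : ℕ) : ℤ) = a % (Nat.gcd n k : ℕ) →
      l a = ((k - (I s : ℕ) : ℕ) : ℤ)) (hper : ∀ a, l (a + n) = l a) :
    Represents (matrixC n k I) (entryC n l) := by
  have row : ∀ a : ℕ, ∀ ha : a < n, ∀ b : ℤ, matrixC n k I ⟨a, ha⟩ (finOfInt n b) =
      basicRow n (l a).toNat (finOfInt n (b - a)) := by
    intro a ha b
    unfold matrixC
    simp only
    rw [cyclicShift_iterate_finOfInt, hl a ⟨a % Nat.gcd n k, Nat.mod_lt _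
      (Nat.gcd_pos_of_pos_left k (NeZero.pos n))⟩ (by simp)]
    simp
  have hle : ∀ a : ℕ, 0 ≤ l a ∧ l a ≤ k := by
    intro a
    have hlt : a % Nat.gcd n k < Nat.gcd n k :=
      Nat.mod_lt _ (Nat.gcd_pos_of_pos_left k (NeZero.pos n))
    have := hl a ⟨a % Nat.gcd n k, hlt⟩ (by simp)
    rw [this]
    omega
  refine represents_of_nonneg (fun a b => ?_) (fun x => ?_) (fun a ha b hab hba => ?_)
  · unfold entryC
    rw [hper]
    congr 1
    · simp only [eq_iff_iff]; omega
    · congr 1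
      simp only [eq_iff_iff]; omega
  · have := row x x.isLt (x : ℕ)
    rw [finOfInt_coe] at this
    have h0 : ((finOfInt n 0 : Fin n) : ℕ) = 0 := by
      have := coe_finOfInt_of_lt (n := n) (a := 0) le_rfl (by exact_mod_cast NeZero.pos n)
      omega
    rw [show (⟨x, x.isLt⟩ : Fin n) = x from rfl] at this
    rw [this, sub_self]
    simp [basicRow, h0]
  · have h := hle a
    have e := coe_finOfInt_of_lt (n := n) (a := b - a) (by omega) (by omega)
    rw [row a ha b]
    unfold basicRow entryC
    split_ifs <;> omega

theorem rowY_zero (n : ℕ) (j : Fin n) : rowY n 0 j =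
    if (j : ℕ) = 0 then 0 else if (j : ℕ) = 1 then 2 else if (j : ℕ) < n / 2 then 1 else -1 := by
  unfold rowY
  rcases (j : ℕ) with _ | _ | b <;> simp

theorem rowY_one (n : ℕ) (j : Fin n) : rowY n 1 j =
    if (j : ℕ) = 0 then -2 else if (j : ℕ) = 1 then 0
      else if (j : ℕ) < n / 2 + 2 then 1 else -1 := by
  unfold rowY
  rcases (j : ℕ) with _ | _ | b <;> simp

theorem rowZ_zero (n : ℕ) (j : Fin n) : rowZ n 0 j =
    if (j : ℕ) = 0 then 0 else if (j : ℕ) ≤ (n - 1) / 2 then 1 else -1 := by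
  unfold rowZ
  rcases (j : ℕ) with _ | b <;> simp

theorem rowZ_one (n : ℕ) (j : Fin n) : rowZ n 1 j =
    if (j : ℕ) = 0 then -1 else if (j : ℕ) = 1 then 0 else if (j : ℕ) ≤ 3 then 2
      else if (j : ℕ) ≤ (n - 1) / 2 then 1 else -1 := by
  unfold rowZ
  rcases (j : ℕ) with _ | _ | _ | _ | b <;> simp

theorem rowZ_two (n : ℕ) (j : Fin n) : rowZ n 2 j =
    if (j : ℕ) = 0 then -1 else if (j : ℕ) = 1 then -2 else if (j : ℕ) = 2 then 0
      else if (j : ℕ) = 3 then 2 else if (j : ℕ) ≤ (n - 1) / 2 + 2 then 1 else -1 := by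
  unfold rowZ
  rcases (j : ℕ) with _ | _ | _ | _ | b <;> simp

theorem rowZ_three (n : ℕ) (j : Fin n) : rowZ n 3 j =
    if (j : ℕ) = 0 then -1 else if (j : ℕ) ≤ 2 then -2 else if (j : ℕ) = 3 then 0
      else if (j : ℕ) ≤ (n - 1) / 2 + 4 then 1 else -1 := by
  unfold rowZ
  rcases (j : ℕ) with _ | _ | _ | _ | b <;> simp

theorem rowZ_four (n : ℕ) (j : Fin n) : rowZ n 4 j =
    if (j : ℕ) ≤ 3 then -1 else if (j : ℕ) = 4 then 0
      else if (j : ℕ) ≤ (n - 1) / 2 + 4 then 1 else -1 := by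
  unfold rowZ
  rcases (j : ℕ) with _ | _ | _ | _ | _ | b <;> simp

theorem represents_matrixY {n k : ℕ} [NeZero n] (hk : 1 ≤ k) (hn : n = 2 * (2 * k + 1)) :
    Represents (matrixY n) (entryY (2 * k + 1)) := by
  have row : ∀ a : ℕ, ∀ ha : a < n, ∀ b : ℤ, matrixY n ⟨a, ha⟩ (finOfInt n b) =
      rowY n (a % 2) (finOfInt n (b - 2 * (a / 2 : ℕ))) := by
    intro a ha b
    unfold matrixY
    simp only
    rw [cyclicShift_iterate_finOfInt]
    congr 2
  refine represents_of_nonneg (fun a b => ?_) (fun x => ?_) (fun a ha b hab hba => ?_)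
  · unfold entryY
    split_ifs <;> omega
  · have hx := x.isLt
    have := row x x.isLt (x : ℕ)
    rw [finOfInt_coe] at this
    have e := coe_finOfInt_of_lt (n := n) (a := (x : ℕ) - 2 * ((x : ℕ) / 2 : ℕ)) (by omega)
      (by omega)
    rw [show (⟨x, x.isLt⟩ : Fin n) = x from rfl] at this
    rw [this]
    rcases Nat.mod_two_eq_zero_or_one x with h | h
    · rw [h, rowY_zero, if_pos (by omega)]
    · rw [h, rowY_one, if_neg (by omega), if_pos (by omega)]
  · rw [row a ha b]
    -- The window of columns starts at the diagonal, not at the first column of the block, so its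
    -- end may wrap around by one period.
    have key : ∃ x : ℤ, finOfInt n (b - 2 * (a / 2 : ℕ)) = finOfInt n x ∧ 0 ≤ x ∧ x < n ∧
        (x = b - 2 * (a / 2 : ℕ) ∨ x = b - 2 * (a / 2 : ℕ) - n) := by
      rcases lt_or_ge (b - 2 * (a / 2 : ℕ)) n with h | h
      · exact ⟨_, rfl, by omega, h, Or.inl rfl⟩
      · refine ⟨b - 2 * (a / 2 : ℕ) + n * (-1), (finOfInt_add_mul _ _).symm, by omega, by omega,
          Or.inr (by ring)⟩
    obtain ⟨x, hx, hx0, hxn, hxe⟩ := key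
    have e := coe_finOfInt_of_lt hx0 hxn
    rw [hx]
    unfold entryY
    rcases Nat.mod_two_eq_zero_or_one a with h | h
    · rw [h, rowY_zero, if_pos (show (a : ℤ) % 2 = 0 by omega)]
      split_ifs <;> omega
    · rw [h, rowY_one, if_neg (show ¬ (a : ℤ) % 2 = 0 by omega)]
      split_ifs <;> omega

theorem represents_matrixZ {n k : ℕ} [NeZero n] (hk : 1 ≤ k) (hn : n = 5 * (2 * k + 1)) :
    Represents (matrixZ n) (entryZ (5 * k + 2)) := by
  have row : ∀ a : ℕ, ∀ ha : a < n, ∀ b : ℤ, matrixZ n ⟨a, ha⟩ (finOfInt n b) =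
      rowZ n (a % 5) (finOfInt n (b - 5 * (a / 5 : ℕ))) := by
    intro a ha b
    unfold matrixZ
    simp only
    rw [cyclicShift_iterate_finOfInt]
    congr 2
  have h5 : ∀ a : ℕ, a % 5 = 0 ∨ a % 5 = 1 ∨ a % 5 = 2 ∨ a % 5 = 3 ∨ a % 5 = 4 := by omega
  refine represents_of_nonneg (fun a b => ?_) (fun x => ?_) (fun a ha b hab hba => ?_)
  · have : (a + n) % 5 = a % 5 := by omega
    unfold entryZ
    rw [this]
    split_ifs <;> omega
  · have hx := x.isLt
    have := row x x.isLt (x : ℕ)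
    rw [finOfInt_coe] at this
    have e := coe_finOfInt_of_lt (n := n) (a := (x : ℕ) - 5 * ((x : ℕ) / 5 : ℕ)) (by omega)
      (by omega)
    rw [show (⟨x, x.isLt⟩ : Fin n) = x from rfl] at this
    rw [this]
    rcases h5 x with h | h | h | h | h
    · rw [h, rowZ_zero]; split_ifs <;> omega
    · rw [h, rowZ_one]; split_ifs <;> omega
    · rw [h, rowZ_two]; split_ifs <;> omega
    · rw [h, rowZ_three]; split_ifs <;> omega
    · rw [h, rowZ_four]; split_ifs <;> omega
  · rw [row a ha b]
    have key : ∃ x : ℤ, finOfInt n (b - 5 * (a / 5 : ℕ)) = finOfInt n x ∧ 0 ≤ x ∧ x < n ∧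
        (x = b - 5 * (a / 5 : ℕ) ∨ x = b - 5 * (a / 5 : ℕ) - n) := by
      rcases lt_or_ge (b - 5 * (a / 5 : ℕ)) n with h | h
      · exact ⟨_, rfl, by omega, h, Or.inl rfl⟩
      · refine ⟨b - 5 * (a / 5 : ℕ) + n * (-1), (finOfInt_add_mul _ _).symm, by omega, by omega,
          Or.inr (by ring)⟩
    obtain ⟨x, hx, hx0, hxn, hxe⟩ := key
    have e := coe_finOfInt_of_lt hx0 hxn
    rw [hx]
    unfold entryZ
    rcases h5 a with h | h | h | h | h
    · rw [h, rowZ_zero, if_pos (show (a : ℤ) % 5 = 0 by omega)]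
      split_ifs <;> omega
    · rw [h, rowZ_one, if_neg (show ¬ (a : ℤ) % 5 = 0 by omega),
        if_pos (show (a : ℤ) % 5 = 1 by omega)]
      split_ifs <;> omega
    · rw [h, rowZ_two, if_neg (show ¬ (a : ℤ) % 5 = 0 by omega),
        if_neg (show ¬ (a : ℤ) % 5 = 1 by omega), if_pos (show (a : ℤ) % 5 = 2 by omega)]
      split_ifs <;> omega
    · rw [h, rowZ_three, if_neg (show ¬ (a : ℤ) % 5 = 0 by omega),
        if_neg (show ¬ (a : ℤ) % 5 = 1 by omega), if_neg (show ¬ (a : ℤ) % 5 = 2 by omega),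
        if_pos (show (a : ℤ) % 5 = 3 by omega)]
      split_ifs <;> omega
    · rw [h, rowZ_four, if_neg (show ¬ (a : ℤ) % 5 = 0 by omega),
        if_neg (show ¬ (a : ℤ) % 5 = 1 by omega), if_neg (show ¬ (a : ℤ) % 5 = 2 by omega),
        if_neg (show ¬ (a : ℤ) % 5 = 3 by omega)]
      split_ifs <;> omega

end Entries

/-! ### Matching the classified rows with the entries. -/

namespace CyclicBumps

variable {n : ℤ} {A : ℤ → ℤ → ℝ}

theorem entryY_eq (h : CyclicBumps n A) {i k : ℤ} (hn : n = 2 * (2 * k + 1))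
    (hY : ∀ t, A (i + 2 * t) (i + 2 * t + 1) = 2 ∧
      (∀ j, i + 2 * t + 1 < j → j < i + 2 * t + (2 * k + 1) → A (i + 2 * t) j = 1) ∧
      (∀ j, i + 2 * t + (2 * k + 1) ≤ j → j < i + 2 * t + n → A (i + 2 * t) j = -1) ∧
      (∀ j, i + 2 * t + 1 < j → j < i + 2 * t + (2 * k + 1) + 2 → A (i + 2 * t + 1) j = 1) ∧
      (∀ j, i + 2 * t + (2 * k + 1) + 2 ≤ j → j < i + 2 * t + n → A (i + 2 * t + 1) j = -1))
    (a b : ℤ) (hab : a < b) (hba : b < a + n) :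
    A (i + a) (i + b) = entryY (2 * k + 1) a b := by
  unfold entryY
  obtain ⟨y1, y2, y3, y4, y5⟩ := hY (a / 2)
  by_cases ha : a % 2 = 0
  · rw [if_pos ha]
    rw [show i + 2 * (a / 2) = i + a by omega] at *
    split_ifs with c1 c2
    · rw [c1, ← add_assoc, y1]; norm_num
    · rw [y2 _ (by omega) (by omega)]; norm_num
    · rw [y3 _ (by omega) (by omega)]; norm_num
  · rw [if_neg ha]
    rw [show i + 2 * (a / 2) + 1 = i + a by omega] at *
    split_ifs with c1 c2
    · rw [y4 _ (by omega) (by omega)]; norm_num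
    · rw [y5 _ (by omega) (by omega)]; norm_num
    -- The last column is the preceding edge of weight 2, reflected.
    · rw [show i + b = i + 2 * (a / 2) + n by omega, h.flip, y1]; norm_num

theorem entryZ_eq {i s : ℤ} (hn : n = 2 * s + 1)
    (hZ : ∀ t, IsZHead s n A (i + 5 * t) ∧ IsZTail s n A (i + 5 * t))
    (a b : ℤ) (hab : a < b) (hba : b < a + n) :
    A (i + a) (i + b) = entryZ s a b := by
  unfold entryZ
  obtain ⟨head, tail⟩ := hZ (a / 5)
  obtain ⟨j, hj⟩ : ∃ j, j = i + 5 * (a / 5) := ⟨_, rfl⟩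
  rw [← hj] at head tail
  obtain ⟨z1, z2, ⟨z3, z4⟩, z5, z6⟩ := head
  obtain ⟨w1, w2, w3, w4, w5, w6, ⟨w7, w8⟩, w9, w10⟩ := tail
  have h5 : a % 5 = 0 ∨ a % 5 = 1 ∨ a % 5 = 2 ∨ a % 5 = 3 ∨ a % 5 = 4 := by omega
  rcases h5 with h | h | h | h | h
  · rw [show i + a = j by omega]
    split_ifs
    · rw [z1 _ (by omega) (by omega)]; norm_num
    · rw [z2 _ (by omega) (by omega)]; norm_num
  · rw [show i + a = j + 1 by omega]
    split_ifs
    · omega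
    · omega
    · obtain e | e : i + b = j + 2 ∨ i + b = j + 3 := by omega
      · rw [e, z3]; norm_num
      · rw [e, z4]; norm_num
    · rw [z5 _ (by omega) (by omega)]; norm_num
    · rw [z6 _ (by omega) (by omega)]; norm_num
  · rw [show i + a = j + 2 by omega, if_neg (by omega), if_neg (by omega), if_pos h]
    split_ifs
    · rw [show i + b = j + 3 by omega, w1]; norm_num
    · rw [w2 _ (by omega) (by omega)]; norm_num
    · rw [w3 _ (by omega) (by omega)]; norm_num
    · rw [show i + b = j + n + 1 by omega, w4]; norm_num
  · rw [show i + a = j + 3 by omega, if_neg (by omega), if_neg (by omega), if_neg (by omega),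
      if_pos h]
    split_ifs
    · rw [w5 _ (by omega) (by omega)]; norm_num
    · rw [w6 _ (by omega) (by omega)]; norm_num
    · obtain e | e : i + b = j + n + 1 ∨ i + b = j + n + 2 := by omega
      · rw [e, w7]; norm_num
      · rw [e, w8]; norm_num
  · rw [show i + a = j + 4 by omega, if_neg (by omega), if_neg (by omega), if_neg (by omega),
      if_neg (by omega)]
    split_ifs
    · rw [w9 _ (by omega) (by omega)]; norm_num
    · rw [w10 _ (by omega) (by omega)]; norm_num

end CyclicBumps

/-! ### From the real classification to the listed matrices. -/

namespace CyclicNumbering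

variable {n : ℕ} {B : Matrix (Fin n) (Fin n) ℂ} {u : ℤ → Fin n} {c : ℂ} {A : ℤ → ℤ → ℝ} {r : ℝ}

theorem isProjEquiv_matrixC (hu : CyclicNumbering B u) (hc : c ≠ 0) (hA : CyclicBumps n A)
    (hBA : ∀ i j, B (u i) (u j) = c * A i j) (hr : 0 < r)
    (hC : CyclicBumps.IsC n fun i j => r * A i j) :
    ∃ (k : ℕ) (I : Fin (Nat.gcd n k) → Fin 2),
      1 ≤ k ∧ 2 * k < n ∧ ¬ (k = 1 ∧ ∀ s, I s = 1) ∧ IsProjEquiv B (matrixC n k I) := by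
  obtain ⟨k', l, hk1, hk2, hl, hl1, hlk, hln, hE⟩ := hC
  obtain ⟨k, rfl⟩ : ∃ k : ℕ, k' = k := ⟨k'.toNat, by omega⟩
  have h3 := hu.three_le
  have : NeZero n := ⟨by omega⟩
  -- By Bézout, the periods `n` and `k` of `l` make `gcd n k` a period.
  have hd : ∀ a m : ℤ, l (a + (Nat.gcd n k : ℕ) * m) = l a := by
    intro a m
    have e := Nat.gcd_eq_gcd_ab n k
    rw [e, show a + (n * Nat.gcdA n k + k * Nat.gcdB n k) * m =
      a + n * (Nat.gcdA n k * m) + k * (Nat.gcdB n k * m) by ring, periodic_add_mul hlk,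
      periodic_add_mul hln]
  refine ⟨k, fun s => if l (s : ℕ) = k then 0 else 1, by omega, by omega, ?_, ?_⟩
  -- Every row has at least one 1, so for `k = 1` the lengths all equal `k` and `I` is zero.
  · rintro ⟨rfl, hI⟩
    have := hI ⟨0, by simp⟩
    have h1 := hl1 0
    have h2 := hl 0
    have h4 : l 0 = (1 : ℕ) := by push_cast; push_cast at h2; omega
    simp [h4] at this
  · refine hu.isProjEquiv_of_represents hc hA hBA
      (represents_matrixC (k := k) _ (by omega) l (fun a s hs => ?_) hln) hr 0 (fun a b hab hba => ?_)
    · have e1 := Int.emod_add_mul_ediv a (Nat.gcd n k : ℕ)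
      have e2 : l a = l (s : ℕ) := by
        rw [hs, ← hd (a % (Nat.gcd n k : ℕ)) (a / (Nat.gcd n k : ℕ)), e1]
      rw [e2]
      have h2 := hl (s : ℕ)
      by_cases h : l (s : ℕ) = k
      · simp [h]
      · simp only [h, if_false]
        simp only [Fin.isValue, Fin.coe_ofNat_eq_mod]
        omega
    · rw [zero_add, zero_add]
      refine (hE a b hab hba).trans ?_
      unfold entryC
      split_ifs <;> norm_num

theorem isProjEquiv_matrixX4 {B : Matrix (Fin 4) (Fin 4) ℂ} {u : ℤ → Fin 4}
    (hu : CyclicNumbering B u) (hc : c ≠ 0)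
    (hA : CyclicBumps 4 A) (hBA : ∀ i j, B (u i) (u j) = c * A i j) (hr : 0 < r) {d : ℝ} {i : ℤ}
    (hd : 0 < d) (hX : CyclicBumps.IsX4At (fun i j => r * A i j) d i) :
    IsProjEquiv B matrixX4 := by
  obtain ⟨h1, h2, h3, h4, h5, h6⟩ := hX
  have hr' : (r : ℂ) ≠ 0 := by exact_mod_cast hr.ne'
  have hd' : (d : ℂ) ≠ 0 := by exact_mod_cast hd.ne'
  refine hu.isProjEquiv (c := c * d / r) (by simp [hc, hr', hd']) i fun x y => ?_
  have key : r * A (i + (x : ℕ)) (i + (y : ℕ)) = d * matrixX4 x y := by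
    fin_cases x <;> fin_cases y <;> simp [matrixX4, hA.diag] <;>
      first
      | linarith
      | (rw [hA.skew]; linarith)
  rw [hBA]
  have key' : (r : ℂ) * A (i + (x : ℕ)) (i + (y : ℕ)) = d * matrixX4 x y := by exact_mod_cast key
  field_simp
  linear_combination key'

theorem isProjEquiv_matrixX5 {B : Matrix (Fin 5) (Fin 5) ℂ} {u : ℤ → Fin 5}
    (hu : CyclicNumbering B u) (hc : c ≠ 0)
    (hA : CyclicBumps 5 A) (hBA : ∀ i j, B (u i) (u j) = c * A i j) (hr : 0 < r) {i : ℤ}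
    (hX : CyclicBumps.IsX5At (fun i j => r * A i j) 1 i) :
    IsProjEquiv B matrixX5 := by
  obtain ⟨h1, h2, h3, h4, h5, h6, h7, h8, h9, h10⟩ := hX
  have hr' : (r : ℂ) ≠ 0 := by exact_mod_cast hr.ne'
  refine hu.isProjEquiv (c := c / r) (by simp [hc, hr']) i fun x y => ?_
  have key : r * A (i + (x : ℕ)) (i + (y : ℕ)) = matrixX5 x y := by
    fin_cases x <;> fin_cases y <;> simp [matrixX5, hA.diag] <;>
      first
      | linarith
      | (rw [hA.skew]; linarith)
      | (simp at h6; exact h6)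
      | (rw [hA.skew]; simp at h6; simp [h6])
  rw [hBA]
  have key' : (r : ℂ) * A (i + (x : ℕ)) (i + (y : ℕ)) = matrixX5 x y := by exact_mod_cast key
  field_simp
  linear_combination key'

theorem classification (hB : B.transpose = -B) (hrow : ∀ i, ∑ j, B i j = 0)
    (hu : CyclicNumbering B u) :
    (∃ (k : ℕ) (I : Fin (Nat.gcd n k) → Fin 2),
          1 ≤ k ∧ 2 * k < n ∧ ¬ (k = 1 ∧ ∀ s, I s = 1) ∧ IsProjEquiv B (matrixC n k I)) ∨
      IsProjEquiv B matrixX4 ∨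
      IsProjEquiv B matrixX5 ∨
      (∃ k : ℕ, 1 ≤ k ∧ IsProjEquiv B (matrixY (2 * (2 * k + 1)))) ∨
      (∃ k : ℕ, 1 ≤ k ∧ IsProjEquiv B (matrixZ (5 * (2 * k + 1)))) := by
  obtain ⟨c, A, hc, hA, hBA⟩ := hu.exists_cyclicBumps hB hrow
  have h3 := hu.three_le
  have : NeZero n := ⟨by omega⟩
  obtain ⟨r, hr, hC | ⟨h4, d, i, hd, hX⟩ | ⟨h5, i, hX⟩ | ⟨i, k', hk, hn, hY⟩ | ⟨i, k', hk, hn, hZ⟩⟩ :=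
    hA.classification
  · exact Or.inl (hu.isProjEquiv_matrixC hc hA hBA hr hC)
  · obtain rfl : n = 4 := by exact_mod_cast h4
    exact Or.inr (Or.inl (hu.isProjEquiv_matrixX4 hc hA hBA hr hd hX))
  · obtain rfl : n = 5 := by exact_mod_cast h5
    exact Or.inr (Or.inr (Or.inl (hu.isProjEquiv_matrixX5 hc hA hBA hr hX)))
  · obtain ⟨k, rfl⟩ : ∃ k : ℕ, k' = k := ⟨k'.toNat, by omega⟩
    have hnk : n = 2 * (2 * k + 1) := by exact_mod_cast hn
    refine Or.inr (Or.inr (Or.inr (Or.inl ⟨k, by omega, ?_⟩)))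
    rw [← hnk]
    exact hu.isProjEquiv_of_represents hc hA hBA (represents_matrixY (by omega) hnk) hr i
      (CyclicBumps.entryY_eq (hA.smul hr) hn hY)
  · obtain ⟨k, rfl⟩ : ∃ k : ℕ, k' = k := ⟨k'.toNat, by omega⟩
    have hnk : n = 5 * (2 * k + 1) := by exact_mod_cast hn
    refine Or.inr (Or.inr (Or.inr (Or.inr ⟨k, by omega, ?_⟩)))
    rw [← hnk]
    exact hu.isProjEquiv_of_represents hc hA hBA (represents_matrixZ (by omega) hnk) hr i
      (CyclicBumps.entryZ_eq (by omega) hZ)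

end CyclicNumbering

/-! ### The listed matrices have full smoothable cycles. -/

section Converse

variable {n : ℕ} {B : Matrix (Fin n) (Fin n) ℂ}

theorem hasFullSmoothableCycle_of_matrixC (hB : B.transpose = -B) {k : ℕ}
    (I : Fin (Nat.gcd n k) → Fin 2) (hk : 1 ≤ k) (h2k : 2 * k < n)
    (hI : ¬ (k = 1 ∧ ∀ s, I s = 1)) (h : IsProjEquiv B (matrixC n k I)) :
    HasFullSmoothableCycle B hB := by
  have : NeZero n := ⟨by omega⟩
  have hd : 0 < Nat.gcd n k := Nat.gcd_pos_of_pos_right n hk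
  have hdn : (Nat.gcd n k : ℤ) ∣ n := by exact_mod_cast Nat.gcd_dvd_left n k
  have : NeZero (Nat.gcd n k) := ⟨hd.ne'⟩
  obtain ⟨l, hl⟩ : ∃ l : ℤ → ℤ, l = fun a => ((k - (I (finOfInt _ a) : ℕ) : ℕ) : ℤ) := ⟨_, rfl⟩
  have hl1 : ∀ a, 1 ≤ l a ∧ k - 1 ≤ l a ∧ l a ≤ k := by
    intro a
    have h1 : l a = ((k - (I (finOfInt _ a) : ℕ) : ℕ) : ℤ) := by rw [hl]
    have h2 := (I (finOfInt _ a)).isLt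
    refine ⟨?_, by omega, by omega⟩
    -- A row without ones needs `k = 1`; then the gcd is 1 and `I` has a single term, equal to 1,
    -- which is the excluded case.
    by_contra hlt
    refine hI ⟨by omega, fun s => ?_⟩
    obtain rfl : k = 1 := by omega
    have hs : s = finOfInt _ a := by
      have := s.isLt
      have := (finOfInt (Nat.gcd n 1) a).isLt
      simp only [Nat.gcd_one_right] at *
      exact Fin.ext (by omega)
    rw [hs]
    exact Fin.ext (by simp; omega)
  refine h.hasFullSmoothableCycle (by omega) hB
    (represents_matrixC I h2k l (fun a s hs => ?_) (fun a => ?_)) (fun a => ?_)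
    (fun a b hab hba => ?_)
  · have : finOfInt _ a = s := by
      apply Fin.ext
      have := coe_finOfInt (n := Nat.gcd n k) a
      omega
    rw [hl, ← this]
  · obtain ⟨m, hm⟩ := hdn
    rw [hl]
    simp only
    rw [hm, finOfInt_add_mul]
  · have := hl1 a
    unfold entryC
    rw [if_pos (by omega)]
    norm_num
  · have h1 := hl1 a
    have h2 := hl1 (a + 1)
    have e : entryC n l a (a + 1) = 1 := by unfold entryC; rw [if_pos (by omega)]
    have : 0 ≤ entryC n l (a + 1) b - entryC n l a b := by
      unfold entryC; split_ifs <;> omega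
    exact ⟨(entryC n l (a + 1) b - entryC n l a b).toNat, by rw [e, Int.toNat_of_nonneg this]; ring⟩

theorem hasFullSmoothableCycle_of_matrixY (hB : B.transpose = -B) {k : ℕ} (hk : 1 ≤ k)
    (h : IsProjEquiv B (matrixY (2 * (2 * k + 1)))) : HasFullSmoothableCycle B hB := by
  obtain rfl := h.eq_size
  refine h.hasFullSmoothableCycle (by omega) hB (represents_matrixY hk rfl) (fun a => ?_)
    (fun a b hab hba => ?_)
  · unfold entryY
    split_ifs <;> omega
  · have key : ∃ m : ℤ, 0 ≤ m ∧ entryY (2 * k + 1) (a + 1) b - entryY (2 * k + 1) a b =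
        entryY (2 * k + 1) a (a + 1) * m := by
      by_cases ha : a % 2 = 0
      · unfold entryY
        rw [if_neg (show ¬ (a + 1) % 2 = 0 by omega), if_pos ha, if_pos ha, if_pos rfl]
        by_cases hm : b = a + (2 * k + 1) ∨ b = a + (2 * k + 1) + 1
        · exact ⟨1, by omega, by split_ifs <;> omega⟩
        · exact ⟨0, by omega, by split_ifs <;> omega⟩
      · refine ⟨entryY (2 * k + 1) (a + 1) b - entryY (2 * k + 1) a b, ?_, ?_⟩
        · unfold entryY
          rw [if_pos (show (a + 1) % 2 = 0 by omega), if_neg ha]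
          split_ifs <;> omega
        · have : entryY (2 * k + 1) a (a + 1) = 1 := by
            unfold entryY
            rw [if_neg ha, if_pos (by omega)]
          rw [this, one_mul]
    obtain ⟨m, hm, e⟩ := key
    exact ⟨m.toNat, by rw [e, Int.toNat_of_nonneg hm]⟩

theorem hasFullSmoothableCycle_of_matrixZ (hB : B.transpose = -B) {k : ℕ} (hk : 1 ≤ k)
    (h : IsProjEquiv B (matrixZ (5 * (2 * k + 1)))) : HasFullSmoothableCycle B hB := by
  obtain rfl := h.eq_size
  have h5 : ∀ a : ℤ, a % 5 = 0 ∨ a % 5 = 1 ∨ a % 5 = 2 ∨ a % 5 = 3 ∨ a % 5 = 4 := by omega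
  refine h.hasFullSmoothableCycle (by omega) hB (represents_matrixZ hk rfl) (fun a => ?_)
    (fun a b hab hba => ?_)
  · unfold entryZ
    split_ifs <;> omega
  · obtain ⟨s, hs⟩ : ∃ s : ℤ, s = 5 * k + 2 := ⟨_, rfl⟩
    rw [← hs]
    have key : ∃ m : ℤ, 0 ≤ m ∧ entryZ s (a + 1) b - entryZ s a b = entryZ s a (a + 1) * m := by
      rcases h5 a with ha | ha | ha | ha | ha
      · refine ⟨entryZ s (a + 1) b - entryZ s a b, ?_, ?_⟩ <;>
          simp only [entryZ, ha, show (a + 1) % 5 = 1 by omega] <;> norm_num <;> split_ifs <;> omega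
      · simp only [entryZ, ha, show (a + 1) % 5 = 2 by omega]
        norm_num
        by_cases hm : b = a + s ∨ b = a + s + 1
        · exact ⟨1, by omega, by split_ifs <;> omega⟩
        · exact ⟨0, by omega, by split_ifs <;> omega⟩
      · simp only [entryZ, ha, show (a + 1) % 5 = 3 by omega]
        norm_num
        by_cases hm : b = a + s + 1 ∨ b = a + s + 2
        · exact ⟨1, by omega, by split_ifs <;> omega⟩
        · exact ⟨0, by omega, by split_ifs <;> omega⟩
      · refine ⟨entryZ s (a + 1) b - entryZ s a b, ?_, ?_⟩ <;>
          simp only [entryZ, ha, show (a + 1) % 5 = 4 by omega] <;> norm_num <;> split_ifs <;> omega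
      · refine ⟨entryZ s (a + 1) b - entryZ s a b, ?_, ?_⟩ <;>
          simp only [entryZ, ha, show (a + 1) % 5 = 0 by omega] <;> norm_num <;> split_ifs <;> omega
    obtain ⟨m, hm, e⟩ := key
    exact ⟨m.toNat, by rw [e, Int.toNat_of_nonneg hm]⟩

/-- The criterion for a full smoothable cycle in terms of all pairs of indices. -/
theorem IsProjEquiv.hasFullSmoothableCycle_of_succ {m : ℕ} (hB : B.transpose = -B)
    {M : Matrix (Fin (m + 3)) (Fin (m + 3)) ℤ} (hd : ∀ x, M x x = 0) (h0 : ∀ x, M x (x + 1) ≠ 0)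
    (h : ∀ x y, y ≠ x → y ≠ x + 1 → ∃ t : Fin 3, M (x + 1) y - M x y = M x (x + 1) * (t : ℕ))
    (hBM : IsProjEquiv B M) : HasFullSmoothableCycle B hB := by
  obtain rfl := hBM.eq_size
  have hsucc : ∀ a, finOfInt (m + 3) (a + 1) = finOfInt (m + 3) a + 1 := fun a => by
    rw [← finRotate_finOfInt, finRotate_apply]
  refine hBM.hasFullSmoothableCycle (by omega) hB
    (E := fun a b => M (finOfInt _ a) (finOfInt _ b)) ⟨hd, fun _ _ _ _ => rfl⟩ (fun a => ?_)
    (fun a b hab hba => ?_)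
  · rw [hsucc]; exact h0 _
  · have ne : ∀ j, j < b → b < j + (m + 3 : ℕ) → finOfInt (m + 3) b ≠ finOfInt (m + 3) j := by
      intro j h1 h2 e
      have := Int.ModEq.dvd (finOfInt_eq_iff.1 e).symm
      have := Int.eq_zero_of_abs_lt_dvd this (by rw [abs_lt]; omega)
      omega
    obtain ⟨t, ht⟩ := h (finOfInt _ a) (finOfInt _ b) (ne a (by omega) hba)
      (by rw [← hsucc]; exact ne (a + 1) hab (by omega))
    exact ⟨t, by rw [hsucc]; exact ht⟩

end Converse

theorem theoremC (n : ℕ) (B : Matrix (Fin n) (Fin n) ℂ) (hB : B.transpose = -B)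
    (hrow : ∀ i, ∑ j, B i j = 0) :
    HasFullSmoothableCycle B hB ↔
      (∃ (k : ℕ) (I : Fin (Nat.gcd n k) → Fin 2),
          1 ≤ k ∧ 2 * k < n ∧ ¬ (k = 1 ∧ ∀ s, I s = 1) ∧ IsProjEquiv B (matrixC n k I)) ∨
      IsProjEquiv B matrixX4 ∨
      IsProjEquiv B matrixX5 ∨
      (∃ k : ℕ, 1 ≤ k ∧ IsProjEquiv B (matrixY (2 * (2 * k + 1)))) ∨
      (∃ k : ℕ, 1 ≤ k ∧ IsProjEquiv B (matrixZ (5 * (2 * k + 1)))) := by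
  constructor
  · rw [hasFullSmoothableCycle_iff]
    rintro ⟨u, hu⟩
    exact hu.classification hB hrow
  · rintro (⟨k, I, hk, h2k, hI, h⟩ | h | h | ⟨k, hk, h⟩ | ⟨k, hk, h⟩)
    · exact hasFullSmoothableCycle_of_matrixC hB I hk h2k hI h
    -- The size is `m + 3`. Multipliers in `Fin 3` suffice because the bumps of a step add up to
    -- two, and they make all conditions decidable.
    · exact h.hasFullSmoothableCycle_of_succ (m := 1) hB (by decide) (by decide) (by decide)
    · exact h.hasFullSmoothableCycle_of_succ (m := 2) hB (by decide) (by decide) (by decide)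
    · exact hasFullSmoothableCycle_of_matrixY hB hk h
    · exact hasFullSmoothableCycle_of_matrixZ hB hk h
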